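/- Theorem 3.3. Let $n\ge 2$ be an integer. Let $\mathcal O_n$ be the Cuntz algebra, i.e. the universal unital $C^*$-algebra generated by isometries $S_1,\dots,S_n$ with $\sum_{i=1}^n S_iS_i^*=1$, and let $\mathcal D_n\subset\mathcal O_n$ be its diagonal subalgebra, i.e. the $C^*$-subalgebra generated by all projections $S_\alpha S_\alpha^*$, where $S_\alpha=S_{\alpha_1}\cdots S_{\alpha_k}$ for a finite multi-index $\alpha=(\alpha_1,\dots,\alpha_k)\in\{1,\dots,n\}^k$, $k\ge 0$. Let ${\rm Aut}(\mathcal D_n)$ be the group of $*$-automorphisms of $\mathcal D_n$, let ${\rm EndAut}(\mathcal O_n,\mathcal D_n)$ be the semigroup of those unital $*$-endomorphisms of $\mathcal O_n$ that restrict to automorphisms of $\mathcal D_n$, and call an endomorphism of $\mathcal O_n$ proper if it is not an automorphism. Let $$r:{\rm EndAut}(\mathcal O_n,\mathcal D_n)\to{\rm Aut}(\mathcal D_n),\qquad r(\gamma)=\gamma|_{\mathcal D_n},$$ be the restriction map. Then: 1. $r$ is not surjective; 2. the image $r({\rm EndAut}(\mathcal O_n,\mathcal D_n))$ is not a subgroup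 of ${\rm Aut}(\mathcal D_n)$; 3. the set of automorphisms of $\mathcal D_n$ that extend to automorphisms of $\mathcal O_n$ is a subgroup of ${\rm Aut}(\mathcal D_n)$, the set of automorphisms of $\mathcal D_n$ that extend to proper endomorphisms of $\mathcal O_n$ is a subsemigroup of ${\rm Aut}(\mathcal D_n)$, and the image of $r$ is the disjoint union of these two sets. -/

import Mathlib

open scoped ENNReal

/-! ### Cuntz families and the Cuntz algebra -/

/-- A family of `n` isometries in a unital `*`-ring whose range projections sum to `1`. -/
structure IsCuntzFamily {n : ℕ} {B : Type*} [Ring B] [StarRing B] (T : Fin n → B) : Prop where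
  isometry : ∀ i, star (T i) * T i = 1
  sum_range : ∑ i, T i * star (T i) = 1

/-- A (nonzero, unital) C*-algebra together with a Cuntz family in it, i.e. a representation of
the defining relations of the Cuntz algebra. -/
structure CuntzRep (n : ℕ) : Type 1 where
  carrier : Type
  [cstar : CStarAlgebra carrier]
  [nontrivial : Nontrivial carrier]
  gen : Fin n → carrier
  isCuntz : IsCuntzFamily gen

attribute [instance] CuntzRep.cstar CuntzRep.nontrivial

/-- The `ℓ^∞`-product of all the C*-algebras carrying a Cuntz family. -/
def CuntzProduct (n : ℕ) : Type 1 := lp (fun ρ : CuntzRep n => ρ.carrier) ∞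

noncomputable def CuntzProduct.cstarAlgebra (n : ℕ) : CStarAlgebra (CuntzProduct n) :=
  let _ : CStarAlgebra (lp (fun ρ : CuntzRep n => ρ.carrier) ∞) := { }
  inferInstanceAs (CStarAlgebra (lp (fun ρ : CuntzRep n => ρ.carrier) ∞))

noncomputable instance CuntzProduct.instCStarAlgebra (n : ℕ) : CStarAlgebra (CuntzProduct n) :=
  CuntzProduct.cstarAlgebra n

/-- The coordinate projections of the product. -/
noncomputable def CuntzProduct.proj {n : ℕ} (ρ : CuntzRep n) :
    CuntzProduct n →⋆ₐ[ℂ] ρ.carrier where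
  toFun x := x.1 ρ
  map_one' := rfl
  map_mul' _ _ := rfl
  map_zero' := rfl
  map_add' _ _ := rfl
  commutes' _ := rfl
  map_star' _ := rfl

theorem norm_isometry_le {B : Type*} [CStarAlgebra B] [Nontrivial B] {s : B}
    (h : star s * s = 1) : ‖s‖ ≤ 1 := by
  have h1 : ‖s‖ * ‖s‖ = 1 := by
    rw [← CStarRing.norm_star_mul_self, h, CStarRing.norm_one]
  nlinarith [norm_nonneg s]

/-- The tuple `(T_i)_T` of the `i`-th isometries of all Cuntz families. -/
noncomputable def CuntzProduct.gen (n : ℕ) (i : Fin n) : CuntzProduct n :=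
  ⟨fun ρ => ρ.gen i, memℓp_infty ⟨1, by
    rintro _ ⟨ρ, rfl⟩
    exact norm_isometry_le (ρ.isCuntz.isometry i)⟩⟩

/-- The C*-subalgebra of the product generated by the universal Cuntz family. -/
noncomputable def cuntzSubalgebra (n : ℕ) : StarSubalgebra ℂ (CuntzProduct n) :=
  (StarAlgebra.adjoin ℂ (Set.range (CuntzProduct.gen n))).topologicalClosure

/-- The Cuntz algebra `𝒪_n`, the universal (unital) C*-algebra generated by `n` isometries whose
ranges sum up to `1`, realized as the C*-algebra generated by the universal Cuntz family inside
the product of all C*-algebras carrying a Cuntz family. That it is generated by its Cuntz family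
and that it has the universal property, with respect to C*-algebras in every universe, is
`CuntzAlgebra.closure_adjoin_S` and `CuntzAlgebra.existsUnique_lift`. -/
def CuntzAlgebra (n : ℕ) : Type 1 := cuntzSubalgebra n

noncomputable def CuntzAlgebra.cstarAlgebra (n : ℕ) : CStarAlgebra (CuntzAlgebra n) :=
  StarSubalgebra.cstarAlgebra (cuntzSubalgebra n)
    (h_closed := StarSubalgebra.isClosed_topologicalClosure _)

noncomputable instance CuntzAlgebra.instCStarAlgebra (n : ℕ) : CStarAlgebra (CuntzAlgebra n) :=
  CuntzAlgebra.cstarAlgebra n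

namespace CuntzAlgebra

/-- The inclusion of `𝒪_n` into the product. -/
noncomputable def incl (n : ℕ) : CuntzAlgebra n →⋆ₐ[ℂ] CuntzProduct n :=
  (cuntzSubalgebra n).subtype

/-- The generating isometries `S_1, …, S_n` of `𝒪_n`. -/
noncomputable def S (n : ℕ) (i : Fin n) : CuntzAlgebra n :=
  ⟨CuntzProduct.gen n i, StarSubalgebra.le_topologicalClosure _
    (StarAlgebra.subset_adjoin ℂ _ ⟨i, rfl⟩)⟩

/-- The representation of `𝒪_n` given by a Cuntz family. -/
noncomputable def eval {n : ℕ} (ρ : CuntzRep n) : CuntzAlgebra n →⋆ₐ[ℂ] ρ.carrier :=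
  (CuntzProduct.proj ρ).comp (incl n)

theorem eval_S {n : ℕ} (ρ : CuntzRep n) (i : Fin n) : eval ρ (S n i) = ρ.gen i := rfl

theorem ext_eval {n : ℕ} {x y : CuntzAlgebra n} (h : ∀ ρ, eval ρ x = eval ρ y) : x = y :=
  Subtype.ext (Subtype.ext (funext h))

theorem isCuntzFamily_S (n : ℕ) : IsCuntzFamily (S n) where
  isometry i := ext_eval fun ρ => by
    rw [map_mul, map_star, map_one, eval_S, ρ.isCuntz.isometry]
  sum_range := ext_eval fun ρ => by
    rw [map_sum, map_one, ← ρ.isCuntz.sum_range]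
    exact Finset.sum_congr rfl fun i _ => by rw [map_mul, map_star, eval_S]

theorem isometry_incl (n : ℕ) : Isometry (incl n) := isometry_subtype_coe

theorem closure_adjoin_S (n : ℕ) :
    (StarAlgebra.adjoin ℂ (Set.range (S n))).topologicalClosure = ⊤ := by
  refine eq_top_iff.2 fun x _ => ?_
  change x ∈ closure (StarAlgebra.adjoin ℂ (Set.range (S n)) : Set (CuntzAlgebra n))
  rw [(isometry_incl n).isUniformInducing.isInducing.closure_eq_preimage_closure_image]
  have h1 : incl n '' (StarAlgebra.adjoin ℂ (Set.range (S n)) : Set (CuntzAlgebra n)) =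
      (StarAlgebra.adjoin ℂ (Set.range (CuntzProduct.gen n)) : Set (CuntzProduct n)) := by
    rw [← StarSubalgebra.coe_map, StarAlgHom.map_adjoin, ← Set.range_comp]
    rfl
  rw [Set.mem_preimage, h1]
  exact x.2

theorem hom_ext {n : ℕ} {B : Type*} [CStarAlgebra B] {φ ψ : CuntzAlgebra n →⋆ₐ[ℂ] B}
    (h : ∀ i, φ (S n i) = ψ (S n i)) : φ = ψ := by
  have hle : (StarAlgebra.adjoin ℂ (Set.range (S n))).topologicalClosure ≤
      StarAlgHom.equalizer φ ψ := by
    refine StarSubalgebra.topologicalClosure_minimal (StarAlgebra.adjoin_le ?_) ?_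
    · rintro _ ⟨i, rfl⟩
      exact h i
    · have hc : ∀ χ : CuntzAlgebra n →⋆ₐ[ℂ] B, Continuous χ := fun χ =>
        AddMonoidHomClass.continuous_of_bound χ 1 fun x => by
          simpa using NonUnitalStarAlgHom.norm_apply_le χ x
      exact isClosed_eq (hc φ) (hc ψ)
  rw [closure_adjoin_S] at hle
  exact StarAlgHom.ext fun x => hle (Set.mem_univ x)

theorem small_closure_adjoin {n : ℕ} {B : Type*} [CStarAlgebra B] (T : Fin n → B) :
    Small.{0} (StarAlgebra.adjoin ℂ (Set.range T)).topologicalClosure := by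
  have h0 : Small.{0} (StarAlgebra.adjoin ℂ (Set.range T)) := by
    have h1 : ((StarAlgebra.adjoin ℂ (Set.range T)).toSubalgebra : Set B) =
        Set.range (FreeAlgebra.lift ℂ (Sum.elim T fun i => star (T i))) := by
      rw [StarAlgebra.adjoin_toSubalgebra, ← AlgHom.coe_range,
        ← Algebra.adjoin_range_eq_range_freeAlgebra_lift, Set.Sum.elim_range]
      congr 3
      ext x
      simp only [Set.mem_star, Set.mem_range]
      exact exists_congr fun i => ⟨fun h => by rw [h, star_star], fun h => by rw [← h, star_star]⟩
    have h2 : Small.{0} (Set.range (FreeAlgebra.lift ℂ (Sum.elim T fun i => star (T i)))) :=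
      inferInstance
    rw [← h1] at h2
    exact h2
  let A := StarAlgebra.adjoin ℂ (Set.range T)
  let lim : {u : ℕ → A // ∃ b ∈ A.topologicalClosure,
      Filter.Tendsto (fun k => (u k : B)) Filter.atTop (nhds b)} → A.topologicalClosure :=
    fun u => ⟨u.2.choose, u.2.choose_spec.1⟩
  refine small_of_surjective (f := lim) ?_
  rintro ⟨b, hb⟩
  obtain ⟨u, hu, hub⟩ := mem_closure_iff_seq_limit.1 hb
  have hu' : ∃ b ∈ A.topologicalClosure, Filter.Tendsto
      (fun k => ((⟨u k, hu k⟩ : A) : B)) Filter.atTop (nhds b) := ⟨b, hb, hub⟩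
  refine ⟨⟨fun k => ⟨u k, hu k⟩, hu'⟩, Subtype.ext ?_⟩
  exact tendsto_nhds_unique hu'.choose_spec.2 hub

universe v

/-- A small C*-algebra has an isomorphic copy in the lowest universe. -/
theorem exists_copy (C : Type v) [CStarAlgebra C] [Small.{0} C] :
    ∃ (D : Type) (_ : CStarAlgebra D), Nonempty (D ≃⋆ₐ[ℂ] C) := by
  let e : Shrink.{0} C ≃ₐ[ℂ] C := Shrink.algEquiv ℂ C
  let i1 : NormedRing (Shrink.{0} C) := NormedRing.induced _ C e.toRingEquiv e.injective
  let i2 : StarRing (Shrink.{0} C) :=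
    { star := fun x => e.symm (star (e x))
      star_involutive := fun x => by simp
      star_mul := fun x y => by simp
      star_add := fun x y => by simp }
  let i3 : NormedAlgebra ℂ (Shrink.{0} C) := NormedAlgebra.induced ℂ _ C e
  have hstar : ∀ x, e (star x) = star (e x) := fun x => e.apply_symm_apply _
  have hiso : Isometry e := fun _ _ => rfl
  have i4 : CompleteSpace (Shrink.{0} C) :=
    (completeSpace_congr (e := e.toEquiv) hiso.isUniformEmbedding).2 inferInstance
  have i5 : CStarRing (Shrink.{0} C) := ⟨fun x => by
    have := CStarRing.norm_mul_self_le (e x)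
    rw [← hstar, ← map_mul] at this
    exact this⟩
  have i6 : StarModule ℂ (Shrink.{0} C) := ⟨fun c x => e.injective (by
    rw [hstar, map_smul, map_smul, hstar, star_smul])⟩
  let i7 : CStarAlgebra (Shrink.{0} C) := { i1, i2, i4, i5, i3, i6 with }
  exact ⟨Shrink.{0} C, i7, ⟨StarAlgEquiv.ofAlgEquiv e hstar⟩⟩

/-- The universal property of `𝒪_n`. -/
theorem existsUnique_lift {n : ℕ} {B : Type v} [CStarAlgebra B] {T : Fin n → B}
    (hT : IsCuntzFamily T) : ∃! φ : CuntzAlgebra n →⋆ₐ[ℂ] B, ∀ i, φ (S n i) = T i := by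
  refine existsUnique_of_exists_of_unique ?_ fun φ ψ hφ hψ =>
    hom_ext fun i => (hφ i).trans (hψ i).symm
  let A := (StarAlgebra.adjoin ℂ (Set.range T)).topologicalClosure
  have : IsClosed (A : Set B) := StarSubalgebra.isClosed_topologicalClosure _
  have : Small.{0} A := small_closure_adjoin T
  let T' : Fin n → A := fun i => ⟨T i, StarSubalgebra.le_topologicalClosure _
    (StarAlgebra.subset_adjoin ℂ _ ⟨i, rfl⟩)⟩
  have hT' : IsCuntzFamily T' :=
    ⟨fun i => Subtype.ext (hT.isometry i), Subtype.ext (by simpa [T'] using hT.sum_range)⟩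
  obtain ⟨D, hD, ⟨e⟩⟩ := exists_copy A
  rcases subsingleton_or_nontrivial D with hs | hnt
  · have : Subsingleton B := subsingleton_of_zero_eq_one (by
      have h01 : (0 : A) = 1 := e.symm.injective (Subsingleton.elim _ _)
      exact congrArg Subtype.val h01)
    exact ⟨{
      toFun := fun _ => 0
      map_one' := Subsingleton.elim _ _
      map_mul' := fun _ _ => Subsingleton.elim _ _
      map_zero' := rfl
      map_add' := fun _ _ => Subsingleton.elim _ _
      commutes' := fun _ => Subsingleton.elim _ _
      map_star' := fun _ => Subsingleton.elim _ _ }, fun _ => Subsingleton.elim _ _⟩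
  · let ρ : CuntzRep n := 
      { carrier := D
        gen := fun i => e.symm (T' i)
        isCuntz := ⟨fun i => by rw [← map_star, ← map_mul, hT'.isometry, map_one],
          by simp_rw [← map_star, ← map_mul, ← map_sum, hT'.sum_range, map_one]⟩ }
    let φ : CuntzAlgebra n →⋆ₐ[ℂ] B := (A.subtype.comp (e : D →⋆ₐ[ℂ] A)).comp (eval ρ)
    refine ⟨φ, fun i => ?_⟩
    change ((e (e.symm (T' i)) : A) : B) = T i
    rw [StarAlgEquiv.apply_symm_apply]

/-! ### The diagonal and the restriction map -/

/-- The isometry `S_α = S_{α_1} ⋯ S_{α_k}` attached to a multi-index `α`. -/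
noncomputable def word {n : ℕ} (α : List (Fin n)) : CuntzAlgebra n := (α.map (S n)).prod

/-- The diagonal `𝒟_n`: the C*-subalgebra of `𝒪_n` generated by the projections `S_α S_α^*`, where
`α` runs over all multi-indices. The span of the `S_α S_α^*` with `α` of length `k` is the
finite-dimensional commutative algebra `𝒟_n^k`; these increase with `k`, so that their union is
the `*`-algebra generated by all `S_α S_α^*`, whose norm closure is taken here. -/
noncomputable def diagonal (n : ℕ) : StarSubalgebra ℂ (CuntzAlgebra n) :=
  (StarAlgebra.adjoin ℂ
    (Set.range fun α : List (Fin n) => word α * star (word α))).topologicalClosure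

/-- `γ` restricts to the automorphism `α` of `𝒟_n`; equivalently, `α` extends to `γ`. -/
def Extends {n : ℕ} (γ : CuntzAlgebra n →⋆ₐ[ℂ] CuntzAlgebra n)
    (α : diagonal n ≃⋆ₐ[ℂ] diagonal n) : Prop :=
  ∀ x : diagonal n, γ x = (α x : CuntzAlgebra n)

theorem Extends.one (n : ℕ) : Extends (1 : CuntzAlgebra n →⋆ₐ[ℂ] CuntzAlgebra n) 1 :=
  fun _ => rfl

theorem Extends.mul {n : ℕ} {γ δ : CuntzAlgebra n →⋆ₐ[ℂ] CuntzAlgebra n}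
    {α β : diagonal n ≃⋆ₐ[ℂ] diagonal n} (h : Extends γ α) (k : Extends δ β) :
    Extends (γ * δ) (α * β) := fun x => by
  change γ (δ x) = _
  rw [k x, h (β x), StarAlgEquiv.mul_apply]

theorem Extends.unique {n : ℕ} {γ : CuntzAlgebra n →⋆ₐ[ℂ] CuntzAlgebra n}
    {α β : diagonal n ≃⋆ₐ[ℂ] diagonal n} (h : Extends γ α) (k : Extends γ β) : α = β :=
  StarAlgEquiv.ext fun x => Subtype.ext ((h x).symm.trans (k x))

/-- `EndAut(𝒪_n, 𝒟_n)`: the semigroup of the unital `*`-endomorphisms of `𝒪_n` that restrict to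
automorphisms of `𝒟_n`. -/
def EndAut (n : ℕ) : Submonoid (CuntzAlgebra n →⋆ₐ[ℂ] CuntzAlgebra n) where
  carrier := {γ | ∃ α : diagonal n ≃⋆ₐ[ℂ] diagonal n, Extends γ α}
  one_mem' := ⟨1, Extends.one n⟩
  mul_mem' := fun ⟨α, h⟩ ⟨β, k⟩ => ⟨α * β, h.mul k⟩

/-- The restriction map `r : EndAut(𝒪_n, 𝒟_n) → Aut(𝒟_n)`. -/
noncomputable def restriction (n : ℕ) : EndAut n →* (diagonal n ≃⋆ₐ[ℂ] diagonal n) where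
  toFun γ := γ.2.choose
  map_one' := Extends.unique (1 : EndAut n).2.choose_spec (Extends.one n)
  map_mul' γ δ := Extends.unique (γ * δ).2.choose_spec (γ.2.choose_spec.mul δ.2.choose_spec)

theorem restriction_apply {n : ℕ} (γ : EndAut n) (x : diagonal n) :
    (restriction n γ x : CuntzAlgebra n) = γ.1 x := (γ.2.choose_spec x).symm

/-- An endomorphism is proper if it is not an automorphism. -/
def IsProper {n : ℕ} (γ : CuntzAlgebra n →⋆ₐ[ℂ] CuntzAlgebra n) : Prop :=
  ¬ Function.Bijective γ

end CuntzAlgebra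

/-!
The infinite words in the alphabet `{0, …, n - 1}` form a Cantor set `X`, and `𝒟_n` is the algebra
of continuous functions on `X`. The whole theorem rests on two facts.

(A) An endomorphism that fixes `𝒟_n` pointwise is an automorphism
(`CuntzAlgebra.bijective_of_fixes_diagonal`). It maps `S_i` to `S_i v_i`, where `v_i` is a unitary
that commutes with `𝒟_n`; as `𝒟_n` is maximal abelian (`CuntzAlgebra.mem_diagonal_of_commute`), the
`v_i` lie in `𝒟_n`, are fixed, and can be undone.

(B) Some proper endomorphism restricts to an automorphism `α` of `𝒟_n`
(`CuntzAlgebra.exists_isProper_extends`).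

By (A), two endomorphisms that extend `α` and `α⁻¹` are automorphisms, so the `α` of (B) is in the
image of the restriction map while `α⁻¹` is not. This gives the first two claims. If `α` extends to
an automorphism `θ`, its inverse extends to `θ⁻¹`, so every extension of `α` is an automorphism; and
if `γ * δ` is an automorphism, then `δ * (γ * δ)⁻¹` extends the inverse of the restriction of `γ`,
so that `γ` is an automorphism. This gives the third claim.

For maximality, represent `𝒪_n` on `ℓ²(X)` by `S_i e_x = e_{ix}`. An element that commutes with
`𝒟_n` is diagonal there, and at a word `x` that is not eventually periodic the diagonal coefficient
of `S_v S_w^*` vanishes unless `v = w`, so that of a finite sum is that of an element of `𝒟_n`. The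
point that remains is that a diagonal element is controlled in norm by these coefficients, although
`𝒪_n` is defined by its universal property and not by this representation
(`CuntzAlgebra.norm_le_of_coeff_self_le`). It follows from an averaging procedure: the positive
unital maps `a ↦ M⁻¹ ∑ ⟨e_{wx}, a e_{vx}⟩ S_w S_v^*`, where `w` and `v` run over the words of length
in `[M, 2M)` and `x` is aperiodic, converge pointwise to the identity, because they multiply each
`S_v S_w^*` by a scalar that tends to `1` (`CuntzAlgebra.average_word`).

For (B), with letters `a ≠ b`, map `S_a` to `S_a²`, `S_b` to a suitable isometry
(`CuntzAlgebra.twist`) and the other generators to themselves. On the one hand all cylinder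
projections lie in the image of `𝒟_n`, so that the image is an abelian algebra containing `𝒟_n` and
equals it by maximality. On the other hand `S_a` is not in the range: near the fixed point `aaa…`
the shift has been replaced by its square, and the vector state at `e_{aaa…}` restricts to the range
in the same way as its composition with `S_i ↦ -S_i`.
-/

namespace CuntzAlgebra

variable {n : ℕ}

/-! ### Words in the generators -/

/-- The generating isometries have orthogonal ranges. -/
theorem star_S_mul_S (i j : Fin n) : star (S n i) * S n j = if i = j then 1 else 0 := by
  split_ifs with hij
  · rw [hij, (isCuntzFamily_S n).isometry]
  let _ := CStarAlgebra.spectralOrder (CuntzAlgebra n)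
  have _ := CStarAlgebra.spectralOrderedRing (CuntzAlgebra n)
  -- `∑ k, (S_k^* S_j)^* (S_k^* S_j) = S_j^* S_j = 1`, and the term with `k = j` is already `1`.
  have h1 : ∑ k, star (star (S n k) * S n j) * (star (S n k) * S n j) = 1 := by
    have h2 : star (S n j) * (∑ k, S n k * star (S n k)) * S n j = 1 := by
      rw [(isCuntzFamily_S n).sum_range, mul_one, (isCuntzFamily_S n).isometry]
    rw [← h2, Finset.mul_sum, Finset.sum_mul]
    exact Finset.sum_congr rfl fun k _ => by simp only [star_mul, star_star, mul_assoc]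
  rw [← Finset.add_sum_erase _ _ (Finset.mem_univ j), (isCuntzFamily_S n).isometry, star_one,
    mul_one, add_eq_left] at h1
  have h3 := (Finset.sum_eq_zero_iff_of_nonneg fun k _ => star_mul_self_nonneg _).1 h1 i
    (Finset.mem_erase.2 ⟨hij, Finset.mem_univ i⟩)
  exact (CStarRing.star_mul_self_eq_zero_iff _).1 h3

@[simp] theorem word_nil : word ([] : List (Fin n)) = 1 := rfl

theorem word_cons (i : Fin n) (w : List (Fin n)) : word (i :: w) = S n i * word w := by
  simp [word]

theorem word_append (v w : List (Fin n)) : word (v ++ w) = word v * word w := by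
  simp [word]

theorem star_word_mul_self (w : List (Fin n)) : star (word w) * word w = 1 := by
  induction w with
  | nil => simp
  | cons i w ih =>
    rw [word_cons, star_mul, mul_assoc, ← mul_assoc (star (S n i)), (isCuntzFamily_S n).isometry,
      one_mul, ih]

theorem star_word_mul_word (v w : List (Fin n)) :
    (∃ t, w = v ++ t ∧ star (word v) * word w = word t) ∨
      (∃ t, v = w ++ t ∧ star (word v) * word w = star (word t)) ∨
      star (word v) * word w = 0 := by
  induction v generalizing w with
  | nil => exact Or.inl ⟨w, rfl, by simp⟩
  | cons i v ih =>
    cases w with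
    | nil => exact Or.inr (Or.inl ⟨i :: v, rfl, by simp⟩)
    | cons j w =>
      have h : star (word (i :: v)) * word (j :: w) =
          star (word v) * (star (S n i) * S n j) * word w := by
        simp only [word_cons, star_mul, mul_assoc]
      rw [h, star_S_mul_S]
      split_ifs with hij
      · subst hij
        rw [mul_one]
        rcases ih w with ⟨t, rfl, h⟩ | ⟨t, rfl, h⟩ | h
        · exact Or.inl ⟨t, rfl, h⟩
        · exact Or.inr (Or.inl ⟨t, rfl, h⟩)
        · exact Or.inr (Or.inr h)
      · simp

/-- The projection `S_w S_w^*` onto the cylinder set of the infinite words that begin with `w`. -/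
noncomputable def cyl (w : List (Fin n)) : CuntzAlgebra n := word w * star (word w)

theorem cyl_nil : cyl ([] : List (Fin n)) = 1 := by simp [cyl]

theorem star_cyl (w : List (Fin n)) : star (cyl w) = cyl w := by simp [cyl]

theorem cyl_cons (i : Fin n) (w : List (Fin n)) :
    cyl (i :: w) = S n i * cyl w * star (S n i) := by
  simp only [cyl, word_cons, star_mul, mul_assoc]

theorem cyl_mul_word_append (v w : List (Fin n)) : cyl v * word (v ++ w) = word (v ++ w) := by
  rw [cyl, word_append, mul_assoc, ← mul_assoc (star (word v)), star_word_mul_self, one_mul]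

theorem cyl_mul_cyl_append (v w : List (Fin n)) : cyl v * cyl (v ++ w) = cyl (v ++ w) := by
  rw [cyl, cyl, ← cyl, ← mul_assoc, cyl_mul_word_append]

theorem cyl_append_mul_cyl (v w : List (Fin n)) : cyl (v ++ w) * cyl v = cyl (v ++ w) := by
  have := congrArg star (cyl_mul_cyl_append v w)
  rwa [star_mul, star_cyl, star_cyl] at this

theorem cyl_mul_cyl_of_eq_zero {v w : List (Fin n)} (h : star (word v) * word w = 0) :
    cyl v * cyl w = 0 := by
  rw [cyl, cyl, mul_assoc, ← mul_assoc (star (word v)), h, zero_mul, mul_zero]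

theorem cyl_comm (v w : List (Fin n)) : cyl v * cyl w = cyl w * cyl v := by
  rcases star_word_mul_word v w with ⟨t, rfl, -⟩ | ⟨t, rfl, -⟩ | h
  · rw [cyl_mul_cyl_append, cyl_append_mul_cyl]
  · rw [cyl_mul_cyl_append, cyl_append_mul_cyl]
  · have h' : star (word w) * word v = 0 := by
      rw [← star_star (word v), ← star_mul, h, star_zero]
    rw [cyl_mul_cyl_of_eq_zero h, cyl_mul_cyl_of_eq_zero h']

theorem sum_cyl_singleton (n : ℕ) : ∑ i, cyl [i] = (1 : CuntzAlgebra n) := by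
  rw [← (isCuntzFamily_S n).sum_range]
  simp [cyl, word_cons]

/-- The linear span of the elements `S_v S_w^*`. -/
noncomputable def wordSpan (n : ℕ) : Submodule ℂ (CuntzAlgebra n) :=
  Submodule.span ℂ (Set.range fun p : List (Fin n) × List (Fin n) => word p.1 * star (word p.2))

theorem word_mul_star_word_mem (v w : List (Fin n)) :
    word v * star (word w) ∈ wordSpan n := Submodule.subset_span ⟨(v, w), rfl⟩

theorem wordSpan_mul_mem {x y : CuntzAlgebra n} (hx : x ∈ wordSpan n) (hy : y ∈ wordSpan n) :
    x * y ∈ wordSpan n := by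
  have hxy := Submodule.mul_mem_mul hx hy
  rw [wordSpan, Submodule.span_mul_span] at hxy
  refine Submodule.span_le.2 ?_ hxy
  rintro _ ⟨_, ⟨⟨v, w⟩, rfl⟩, _, ⟨⟨v', w'⟩, rfl⟩, rfl⟩
  have h : word v * star (word w) * (word v' * star (word w')) =
      word v * (star (word w) * word v') * star (word w') := by simp only [mul_assoc]
  simp only [h, SetLike.mem_coe]
  rcases star_word_mul_word w v' with ⟨t, -, h⟩ | ⟨t, -, h⟩ | h
  · rw [h, ← word_append]
    exact word_mul_star_word_mem _ _
  · rw [h, mul_assoc, ← star_mul, ← word_append]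
    exact word_mul_star_word_mem _ _
  · rw [h, mul_zero, zero_mul]
    exact Submodule.zero_mem _

theorem wordSpan_star_mem {x : CuntzAlgebra n} (hx : x ∈ wordSpan n) : star x ∈ wordSpan n := by
  induction hx using Submodule.span_induction with
  | mem x hx =>
    obtain ⟨⟨v, w⟩, rfl⟩ := hx
    simpa using word_mul_star_word_mem w v
  | zero => simp
  | add x y _ _ hx hy => rw [star_add]; exact Submodule.add_mem _ hx hy
  | smul c x _ hx => rw [star_smul]; exact Submodule.smul_mem _ _ hx

theorem exists_wordSpan_norm_sub_lt (a : CuntzAlgebra n) {ε : ℝ} (hε : 0 < ε) :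
    ∃ y ∈ wordSpan n, ‖a - y‖ < ε := by
  have ha : a ∈ (StarAlgebra.adjoin ℂ (Set.range (S n))).topologicalClosure := by
    rw [closure_adjoin_S]; trivial
  obtain ⟨y, hy, hay⟩ := Metric.mem_closure_iff.1 ha ε hε
  refine ⟨y, ?_, by rwa [← dist_eq_norm]⟩
  clear hay
  induction hy using StarAlgebra.adjoin_induction with
  | mem x hx =>
    obtain ⟨i, rfl⟩ := hx
    simpa [word_cons] using word_mul_star_word_mem [i] []
  | algebraMap r =>
    rw [Algebra.algebraMap_eq_smul_one]
    exact Submodule.smul_mem _ _ (by simpa using word_mul_star_word_mem (n := n) [] [])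
  | add x y _ _ hx hy => exact Submodule.add_mem _ hx hy
  | mul x y _ _ hx hy => exact wordSpan_mul_mem hx hy
  | star x _ hx => exact wordSpan_star_mem hx

/-! ### The diagonal -/

theorem continuous_hom {A B : Type*} [CStarAlgebra A] [CStarAlgebra B] (φ : A →⋆ₐ[ℂ] B) :
    Continuous φ :=
  AddMonoidHomClass.continuous_of_bound φ 1 fun x => by
    simpa using NonUnitalStarAlgHom.norm_apply_le φ x

theorem cyl_mem_diagonal (w : List (Fin n)) : cyl w ∈ diagonal n :=
  StarSubalgebra.le_topologicalClosure _ (StarAlgebra.subset_adjoin ℂ _ ⟨w, rfl⟩)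

theorem isClosed_diagonal (n : ℕ) : IsClosed (diagonal n : Set (CuntzAlgebra n)) :=
  StarSubalgebra.isClosed_topologicalClosure _

/-- The diagonal is the least closed `*`-subalgebra that contains the cylinder projections. -/
theorem diagonal_le {M : StarSubalgebra ℂ (CuntzAlgebra n)}
    (hM : IsClosed (M : Set (CuntzAlgebra n))) (h : ∀ w, cyl w ∈ M) : diagonal n ≤ M :=
  StarSubalgebra.topologicalClosure_minimal
    (StarAlgebra.adjoin_le (by rintro _ ⟨w, rfl⟩; exact h w)) hM

/-- An element that commutes with the cylinder projections commutes with the diagonal. -/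
theorem commute_of_mem_diagonal {a d : CuntzAlgebra n} (ha : ∀ w, cyl w * a = a * cyl w)
    (hd : d ∈ diagonal n) : d * a = a * d := by
  have h1 := StarSubalgebra.topologicalClosure_adjoin_le_centralizer_centralizer
    (R := ℂ) (Set.range fun α : List (Fin n) => word α * star (word α)) hd
  refine ((StarSubalgebra.mem_centralizer_iff ℂ).1 h1 a ?_).1.symm
  rw [SetLike.mem_coe, StarSubalgebra.mem_centralizer_iff]
  rintro _ ⟨w, rfl⟩
  change cyl w * a = a * cyl w ∧ star (cyl w) * a = a * star (cyl w)
  rw [star_cyl]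
  exact ⟨ha w, ha w⟩

theorem diagonal_comm {c d : CuntzAlgebra n} (hc : c ∈ diagonal n) (hd : d ∈ diagonal n) :
    d * c = c * d :=
  commute_of_mem_diagonal (fun w => (commute_of_mem_diagonal (fun v => cyl_comm v w) hc).symm) hd

theorem eqOn_diagonal {B : Type*} [CStarAlgebra B] {φ ψ : CuntzAlgebra n →⋆ₐ[ℂ] B}
    (h : ∀ w, φ (cyl w) = ψ (cyl w)) {d : CuntzAlgebra n} (hd : d ∈ diagonal n) : φ d = ψ d := by
  have : diagonal n ≤ StarAlgHom.equalizer φ ψ :=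
    diagonal_le (isClosed_eq (continuous_hom φ) (continuous_hom ψ)) h
  exact this hd

/-- The diagonal is invariant under the conjugations `d ↦ S_i d S_i^*`. -/
theorem S_mul_mul_star_S_mem_diagonal (i : Fin n) {d : CuntzAlgebra n} (hd : d ∈ diagonal n) :
    S n i * d * star (S n i) ∈ diagonal n := by
  have hc : Continuous fun d : CuntzAlgebra n => S n i * d * star (S n i) := by fun_prop
  have hmaps : Set.MapsTo (fun d : CuntzAlgebra n => S n i * d * star (S n i))
      (StarAlgebra.adjoin ℂ (Set.range fun α : List (Fin n) => word α * star (word α)))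
      (diagonal n) := by
    intro x hx
    simp only [SetLike.mem_coe] at hx ⊢
    induction hx using StarAlgebra.adjoin_induction with
    | mem x hx =>
      obtain ⟨w, rfl⟩ := hx
      change S n i * cyl w * star (S n i) ∈ _
      rw [← cyl_cons]
      exact cyl_mem_diagonal _
    | algebraMap r =>
      rw [Algebra.algebraMap_eq_smul_one, mul_smul_comm, smul_mul_assoc, ← cyl_nil, ← cyl_cons]
      exact (diagonal n).smul_mem (cyl_mem_diagonal _) r
    | add x y _ _ hx hy => rw [mul_add, add_mul]; exact add_mem hx hy
    | mul x y _ _ hx hy =>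
      have : S n i * (x * y) * star (S n i) =
          (S n i * x * star (S n i)) * (S n i * y * star (S n i)) := by
        have h := (isCuntzFamily_S n).isometry i
        simp only [mul_assoc]
        rw [← mul_assoc (star (S n i)) (S n i), h, one_mul]
      rw [this]
      exact mul_mem hx hy
    | star x _ hx =>
      have := star_mem hx
      rwa [star_mul, star_mul, star_star, ← mul_assoc] at this
  have := map_mem_closure hc hd hmaps
  rwa [(isClosed_diagonal n).closure_eq] at this

/-! ### The permutation representation on infinite words -/

open scoped Classical in
/-- The basis vector `e_x` of `ℓ²(X)`, where `X` is the set of infinite words. -/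
noncomputable def basisVec (x : Stream' (Fin n)) : lp (fun _ : Stream' (Fin n) => ℂ) 2 :=
  lp.single 2 x 1

theorem inner_basisVec_left (x : Stream' (Fin n)) (f : lp (fun _ : Stream' (Fin n) => ℂ) 2) :
    inner ℂ (basisVec x) f = f x := by
  classical
  rw [basisVec, lp.inner_single_left]
  simp

theorem orthonormal_basisVec : Orthonormal ℂ (basisVec (n := n)) := by
  classical
  rw [orthonormal_iff_ite]
  intro x y
  rw [inner_basisVec_left, basisVec, lp.single_apply]
  simp [Pi.single_apply]

theorem ext_inner_basisVec {f g : lp (fun _ : Stream' (Fin n) => ℂ) 2}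
    (h : ∀ x, inner ℂ (basisVec x) f = inner ℂ (basisVec x) g) : f = g :=
  lp.ext (funext fun x => by simpa only [inner_basisVec_left] using h x)

theorem inner_basisVec_self (x : Stream' (Fin n)) :
    inner ℂ (basisVec x) (basisVec x) = (1 : ℂ) := by
  rw [inner_self_eq_norm_sq_to_K, orthonormal_basisVec.1 x]; simp

theorem inner_basisVec_of_ne {x y : Stream' (Fin n)} (h : x ≠ y) :
    inner ℂ (basisVec x) (basisVec y) = (0 : ℂ) := orthonormal_basisVec.2 h

/-- The isometry of `ℓ²(X)` with `e_x ↦ e_{ix}`. -/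
noncomputable def prefixIsometry (i : Fin n) :
    lp (fun _ : Stream' (Fin n) => ℂ) 2 →ₗᵢ[ℂ] lp (fun _ : Stream' (Fin n) => ℂ) 2 :=
  (orthonormal_basisVec.comp (Stream'.cons i) (Stream'.cons_injective_right i)
    ).orthogonalFamily.linearIsometry

theorem prefixIsometry_basisVec (i : Fin n) (x : Stream' (Fin n)) :
    prefixIsometry i (basisVec x) = basisVec (Stream'.cons i x) := by
  classical
  have := (orthonormal_basisVec.comp (Stream'.cons i) (Stream'.cons_injective_right i)
    ).orthogonalFamily.linearIsometry_apply_single (i := x) (1 : ℂ)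
  rw [prefixIsometry, basisVec]
  convert this
  simp

theorem adjoint_prefixIsometry_cons (i j : Fin n) (x : Stream' (Fin n)) :
    ContinuousLinearMap.adjoint (prefixIsometry i).toContinuousLinearMap
      (basisVec (Stream'.cons j x)) = if i = j then basisVec x else 0 := by
  refine ext_inner_basisVec fun y => ?_
  rw [ContinuousLinearMap.adjoint_inner_right, LinearIsometry.coe_toContinuousLinearMap,
    prefixIsometry_basisVec]
  split_ifs with hij
  · subst hij
    by_cases hxy : y = x
    · subst hxy
      rw [inner_basisVec_self, inner_basisVec_self]
    · rw [inner_basisVec_of_ne hxy,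
        inner_basisVec_of_ne fun h => hxy (Stream'.cons_injective_right i h)]
  · rw [inner_zero_right, inner_basisVec_of_ne fun h => hij ?_]
    exact congrArg Stream'.head h

theorem isCuntzFamily_prefixIsometry :
    IsCuntzFamily fun i : Fin n => (prefixIsometry i).toContinuousLinearMap where
  isometry i := (prefixIsometry i).adjoint_comp_self
  sum_range := by
    classical
    refine lp.ext_continuousLinearMap (by simp) fun x => ?_
    refine ContinuousLinearMap.ext_ring ?_
    change (∑ i : Fin n, _ : _ →L[ℂ] _) (lp.single 2 x 1) = lp.single 2 x 1
    have hx : (lp.single 2 x 1 : lp (fun _ : Stream' (Fin n) => ℂ) 2) = basisVec x := by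
      rw [basisVec]
    rw [hx, ← Stream'.eta x, sum_apply]
    simp_rw [ContinuousLinearMap.star_eq_adjoint, mul_apply_eq_comp,
      adjoint_prefixIsometry_cons]
    rw [Finset.sum_eq_single x.head]
    · simp [prefixIsometry_basisVec]
    · intro i _ hi
      simp [hi]
    · simp

/-- The representation of `𝒪_n` on `ℓ²(X)` in which `S_i` maps `e_x` to `e_{ix}`. -/
noncomputable def permRep (n : ℕ) : CuntzAlgebra n →⋆ₐ[ℂ]
    (lp (fun _ : Stream' (Fin n) => ℂ) 2 →L[ℂ] lp (fun _ : Stream' (Fin n) => ℂ) 2) :=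
  (existsUnique_lift isCuntzFamily_prefixIsometry).choose

theorem permRep_S (i : Fin n) : permRep n (S n i) = (prefixIsometry i).toContinuousLinearMap :=
  (existsUnique_lift isCuntzFamily_prefixIsometry).choose_spec.1 i

theorem permRep_S_basisVec (i : Fin n) (x : Stream' (Fin n)) :
    permRep n (S n i) (basisVec x) = basisVec (Stream'.cons i x) := by
  rw [permRep_S]; exact prefixIsometry_basisVec i x

theorem permRep_mul_apply (a b : CuntzAlgebra n) (f : lp (fun _ : Stream' (Fin n) => ℂ) 2) :
    permRep n (a * b) f = permRep n a (permRep n b f) := by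
  rw [map_mul]; rfl

theorem inner_permRep (a : CuntzAlgebra n) (f g : lp (fun _ : Stream' (Fin n) => ℂ) 2) :
    inner ℂ f (permRep n a g) = inner ℂ (permRep n (star a) f) g := by
  rw [map_star, ContinuousLinearMap.star_eq_adjoint, ContinuousLinearMap.adjoint_inner_left]

theorem permRep_word_basisVec (w : List (Fin n)) (x : Stream' (Fin n)) :
    permRep n (word w) (basisVec x) = basisVec (w ++ₛ x) := by
  induction w with
  | nil => simp
  | cons i w ih =>
    rw [word_cons, permRep_mul_apply, ih, permRep_S_basisVec, Stream'.cons_append_stream]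

theorem permRep_star_word_basisVec (w : List (Fin n)) (x : Stream' (Fin n)) :
    permRep n (star (word w)) (basisVec (w ++ₛ x)) = basisVec x := by
  rw [← permRep_word_basisVec, ← permRep_mul_apply, star_word_mul_self, map_one]; rfl

theorem permRep_star_word_basisVec_of_ne {w : List (Fin n)} {x : Stream' (Fin n)}
    (h : ∀ y, x ≠ w ++ₛ y) : permRep n (star (word w)) (basisVec x) = 0 := by
  refine ext_inner_basisVec fun y => ?_
  rw [inner_permRep, star_star, permRep_word_basisVec, inner_basisVec_of_ne (h y).symm,
    inner_zero_right]

theorem permRep_cyl_basisVec (w : List (Fin n)) (x : Stream' (Fin n)) :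
    permRep n (cyl w) (basisVec (w ++ₛ x)) = basisVec (w ++ₛ x) := by
  rw [cyl, permRep_mul_apply, permRep_star_word_basisVec, permRep_word_basisVec]

theorem permRep_cyl_basisVec_of_ne {w : List (Fin n)} {x : Stream' (Fin n)}
    (h : ∀ y, x ≠ w ++ₛ y) : permRep n (cyl w) (basisVec x) = 0 := by
  rw [cyl, permRep_mul_apply, permRep_star_word_basisVec_of_ne h, map_zero]

/-- The matrix coefficient `⟨e_x, a e_y⟩` of the representation on `ℓ²(X)`. -/
noncomputable def coeff (x y : Stream' (Fin n)) : CuntzAlgebra n →ₗ[ℂ] ℂ where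
  toFun a := inner ℂ (basisVec x) (permRep n a (basisVec y))
  map_add' a b := by simp
  map_smul' c a := by simp

theorem coeff_apply (x y : Stream' (Fin n)) (a : CuntzAlgebra n) :
    coeff x y a = inner ℂ (basisVec x) (permRep n a (basisVec y)) := rfl

theorem coeff_one_self (x : Stream' (Fin n)) : coeff x x 1 = 1 := by
  rw [coeff_apply, map_one]; exact inner_basisVec_self x

theorem norm_coeff_le (x y : Stream' (Fin n)) (a : CuntzAlgebra n) : ‖coeff x y a‖ ≤ ‖a‖ := by
  have h := norm_inner_le_norm (𝕜 := ℂ) (basisVec x) (permRep n a (basisVec y))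
  have h1 := (permRep n a).le_opNorm (basisVec y)
  rw [orthonormal_basisVec.1] at h h1
  have h2 := NonUnitalStarAlgHom.norm_apply_le (permRep n) a
  rw [coeff_apply]
  linarith

theorem coeff_star (x y : Stream' (Fin n)) (a : CuntzAlgebra n) :
    coeff x y (star a) = star (coeff y x a) := by
  rw [coeff_apply, coeff_apply, inner_permRep, star_star]
  exact (inner_conj_symm _ _).symm

theorem coeff_mul_star_word (v w : List (Fin n)) (x y : Stream' (Fin n)) :
    coeff x y (word v * star (word w)) =
      inner ℂ (permRep n (star (word v)) (basisVec x))
        (permRep n (star (word w)) (basisVec y)) := by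
  rw [coeff_apply, permRep_mul_apply, inner_permRep]

theorem coeff_append_append (v w : List (Fin n)) (x : Stream' (Fin n)) :
    coeff (v ++ₛ x) (w ++ₛ x) (word v * star (word w)) = 1 := by
  rw [coeff_mul_star_word, permRep_star_word_basisVec, permRep_star_word_basisVec,
    inner_basisVec_self]

theorem coeff_word_eq_zero {v w : List (Fin n)} {x y : Stream' (Fin n)}
    (h : ∀ z, x = v ++ₛ z → y ≠ w ++ₛ z) : coeff x y (word v * star (word w)) = 0 := by
  rw [coeff_mul_star_word]
  by_cases hx : ∃ z, x = v ++ₛ z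
  · obtain ⟨z, rfl⟩ := hx
    by_cases hy : ∃ z, y = w ++ₛ z
    · obtain ⟨z', rfl⟩ := hy
      rw [permRep_star_word_basisVec, permRep_star_word_basisVec, inner_basisVec_of_ne]
      rintro rfl
      exact h z rfl rfl
    · push Not at hy
      rw [permRep_star_word_basisVec_of_ne hy, inner_zero_right]
  · push Not at hx
    rw [permRep_star_word_basisVec_of_ne hx, inner_zero_left]

instance [NeZero n] : Nontrivial (CuntzAlgebra n) := by
  refine ⟨⟨0, 1, fun h => ?_⟩⟩
  have h1 := coeff_one_self (n := n) (Stream'.const 0)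
  rw [← h, map_zero] at h1
  exact zero_ne_one h1

theorem take_length_append (w : List (Fin n)) (x : Stream' (Fin n)) :
    (w ++ₛ x).take w.length = w := by
  induction w with
  | nil => rfl
  | cons i w ih => simp [Stream'.cons_append_stream, ih]

/-- Elements that commute with the cylinder projections act diagonally. -/
theorem coeff_eq_zero_of_commute {a : CuntzAlgebra n} (ha : ∀ w, cyl w * a = a * cyl w)
    {x y : Stream' (Fin n)} (hxy : x ≠ y) : coeff x y a = 0 := by
  obtain ⟨k, hk⟩ : ∃ k, x.take k ≠ y.take k := by
    by_contra! h
    exact hxy (Stream'.take_theorem _ _ h)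
  have h1 := permRep_cyl_basisVec (y.take k) (y.drop k)
  rw [Stream'.append_take_drop] at h1
  rw [coeff_apply, ← h1, ← permRep_mul_apply, ← ha, permRep_mul_apply, inner_permRep, star_cyl,
    permRep_cyl_basisVec_of_ne, inner_zero_left]
  rintro z rfl
  apply hk
  simpa using take_length_append (y.take k) z

/-! ### Aperiodic words -/

/-- An infinite word is aperiodic if its shifts are pairwise distinct, that is, if it is not
eventually periodic. -/
def IsAperiodic (x : Stream' (Fin n)) : Prop := ∀ k l, x.drop k = x.drop l → k = l

theorem IsAperiodic.append {x : Stream' (Fin n)} (hx : IsAperiodic x) (w : List (Fin n)) :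
    IsAperiodic (w ++ₛ x) := by
  intro k l h
  refine hx k l ?_
  have h1 := congrArg (Stream'.drop w.length) h
  rw [Stream'.drop_drop, Stream'.drop_drop, add_comm k, add_comm l, ← Stream'.drop_drop,
    ← Stream'.drop_drop, Stream'.drop_append_stream] at h1
  exact h1

theorem append_stream_inj {v w : List (Fin n)} {x y : Stream' (Fin n)}
    (hl : v.length = w.length) (h : v ++ₛ x = w ++ₛ y) : v = w := by
  have h1 := congrArg (Stream'.take v.length) h
  rwa [take_length_append, hl, take_length_append] at h1

theorem IsAperiodic.append_inj {x : Stream' (Fin n)} (hx : IsAperiodic x) {v w : List (Fin n)}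
    (h : v ++ₛ x = w ++ₛ x) : v = w := by
  refine append_stream_inj ?_ h
  have hy := hx.append w
  refine hy _ _ ?_
  rw [Stream'.drop_append_stream, ← h, Stream'.drop_append_stream]

/-- The word with a `1` exactly at the positions `2 ^ k`, and `0` elsewhere, is aperiodic. -/
theorem exists_isAperiodic (hn : 2 ≤ n) : ∃ x : Stream' (Fin n), IsAperiodic x := by
  classical
  let x : Stream' (Fin n) := fun j => if ∃ k, j = 2 ^ k then ⟨1, by omega⟩ else ⟨0, by omega⟩
  refine ⟨x, ?_⟩
  have key : ∀ k l, k < l → x.drop k ≠ x.drop l := by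
    intro k l hkl h
    -- Compare the entries `2 ^ l` and `2 ^ l + (l - k)` of `x`.
    have h1 : l < 2 ^ l := Nat.lt_two_pow_self
    have h2 := congrFun h (2 ^ l - k)
    simp only [Stream'.drop, Stream'.get, x] at h2
    rw [if_pos ⟨l, by omega⟩, if_neg] at h2
    · simp at h2
    · rintro ⟨m, hm⟩
      have h3 : 2 ^ l < 2 ^ m := by omega
      have h4 : 2 ^ (l + 1) ≤ 2 ^ m :=
        Nat.pow_le_pow_right (by norm_num) ((Nat.pow_lt_pow_iff_right (by norm_num)).1 h3)
      rw [pow_succ] at h4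
      omega
  intro k l h
  rcases lt_trichotomy k l with hkl | hkl | hkl
  · exact absurd h (key k l hkl)
  · exact hkl
  · exact absurd h.symm (key l k hkl)

theorem IsAperiodic.coeff_eq_zero {x : Stream' (Fin n)} (hx : IsAperiodic x) {v w : List (Fin n)}
    (hvw : v ≠ w) : coeff x x (word v * star (word w)) = 0 := by
  refine coeff_word_eq_zero fun z h1 h2 => hvw ?_
  refine append_stream_inj ?_ (h1.symm.trans h2)
  refine hx _ _ ?_
  conv_lhs => rw [h1]
  conv_rhs => rw [h2]
  rw [Stream'.drop_append_stream, Stream'.drop_append_stream]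

/-! ### Averaging over words of growing length -/

section SpectralOrder

noncomputable local instance : PartialOrder (CuntzAlgebra n) := CStarAlgebra.spectralOrder _

local instance : StarOrderedRing (CuntzAlgebra n) := CStarAlgebra.spectralOrderedRing _

theorem norm_le_of_neg_le_of_le {A : Type*} [CStarAlgebra A] [PartialOrder A] [StarOrderedRing A]
    {a : A} (ha : IsSelfAdjoint a) {r : ℝ} (hr : 0 ≤ r) (h1 : -algebraMap ℝ A r ≤ a)
    (h2 : a ≤ algebraMap ℝ A r) : ‖a‖ ≤ r := by
  rcases subsingleton_or_nontrivial A with _ | _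
  · simpa [Subsingleton.elim a 0] using hr
  rw [← map_neg] at h1
  rcases CStarAlgebra.norm_or_neg_norm_mem_spectrum ha with h | h
  · exact (le_algebraMap_iff_spectrum_le (R := ℝ) ha).1 h2 _ h
  · exact neg_le_neg_iff.1 ((algebraMap_le_iff_le_spectrum (R := ℝ) ha).1 h1 _ h)

open scoped ComplexOrder in
/-- The sum of `G i j • s_i s_j^*` is positive if `G` is a positive semidefinite matrix of
scalars: with `G i j = ∑ k, v k i * conj (v k j)` it is `∑ k, t_k t_k^*` where
`t_k = ∑ i, v k i • s_i`. -/
theorem sum_smul_mul_star_nonneg {A : Type*} [CStarAlgebra A] [PartialOrder A] [StarOrderedRing A]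
    {ι : Type*} [Fintype ι] (s : ι → A) {G : Matrix ι ι ℂ} (hG : G.PosSemidef) :
    0 ≤ ∑ i, ∑ j, G i j • (s i * star (s j)) := by
  obtain ⟨m, v, rfl⟩ := Matrix.posSemidef_iff_eq_sum_vecMulVec.1 hG
  have h : ∑ i, ∑ j, (∑ k, Matrix.vecMulVec (v k) (star (v k))) i j • (s i * star (s j)) =
      ∑ k, (∑ i, v k i • s i) * star (∑ i, v k i • s i) := by
    simp_rw [Matrix.sum_apply, Finset.sum_smul, star_sum, Finset.sum_mul, Finset.mul_sum, star_smul,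
      smul_mul_smul_comm, Matrix.vecMulVec_apply, Pi.star_apply]
    conv_rhs => rw [Finset.sum_comm]
    exact Finset.sum_congr rfl fun i _ => Finset.sum_comm
  rw [h]
  exact Finset.sum_nonneg fun k _ => mul_star_self_nonneg _

/-- The words of length `m`. -/
noncomputable def wordsOfLength (n m : ℕ) : Finset (List (Fin n)) :=
  (List.finite_length_eq (Fin n) m).toFinset

theorem mem_wordsOfLength {m : ℕ} {w : List (Fin n)} : w ∈ wordsOfLength n m ↔ w.length = m := by
  simp [wordsOfLength]

theorem sum_cyl_wordsOfLength (n m : ℕ) : ∑ w ∈ wordsOfLength n m, cyl w = 1 := by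
  induction m with
  | zero =>
    have : wordsOfLength n 0 = {[]} := by
      ext w; simp [mem_wordsOfLength]
    rw [this, Finset.sum_singleton, cyl_nil]
  | succ m ih =>
    rw [← (isCuntzFamily_S n).sum_range]
    have h1 : ∀ i, S n i * star (S n i) = ∑ w ∈ wordsOfLength n m, cyl (i :: w) := fun i => by
      simp_rw [cyl_cons]
      rw [← Finset.sum_mul, ← Finset.mul_sum, ih, mul_one]
    simp_rw [h1]
    rw [← Finset.sum_product' (f := fun (i : Fin n) w => cyl (i :: w))]
    symm
    refine Finset.sum_bij (fun p _ => p.1 :: p.2) ?_ ?_ ?_ ?_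
    · rintro ⟨i, w⟩ h
      simp only [Finset.mem_product, mem_wordsOfLength] at h ⊢
      simp [h.2]
    · rintro ⟨i, w⟩ _ ⟨j, v⟩ _ h
      simpa using h
    · rintro w hw
      rw [mem_wordsOfLength] at hw
      cases w with
      | nil => simp at hw
      | cons i w => exact ⟨(i, w), by simpa [mem_wordsOfLength] using hw, rfl⟩
    · intros; rfl

/-- The words whose length lies in the interval `[k, l)`. -/
noncomputable def wordsBetween (n k l : ℕ) : Finset (List (Fin n)) :=
  (Finset.Ico k l).biUnion (wordsOfLength n)

theorem mem_wordsBetween {k l : ℕ} {w : List (Fin n)} :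
    w ∈ wordsBetween n k l ↔ k ≤ w.length ∧ w.length < l := by
  simp [wordsBetween, mem_wordsOfLength]

theorem sum_cyl_wordsBetween (n k l : ℕ) :
    ∑ w ∈ wordsBetween n k l, cyl w = ((l - k : ℕ) : ℂ) • 1 := by
  rw [wordsBetween, Finset.sum_biUnion]
  · simp_rw [sum_cyl_wordsOfLength]
    simp [Algebra.smul_def]
  · intro i _ j _ hij
    rw [Function.onFun, Finset.disjoint_left]
    intro w hi hj
    rw [mem_wordsOfLength] at hi hj
    exact hij (hi.symm.trans hj)

/-- The compression of `a` to the span of the `e_{wx}` with `w` of length in `[M, 2M)`, pushed back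
into `𝒪_n` by replacing the matrix unit between `e_{wx}` and `e_{vx}` by `S_w S_v^*`, and
divided by `M`. For an aperiodic `x` this tends to `a` as `M` grows. -/
noncomputable def average (x : Stream' (Fin n)) (M : ℕ) :
    CuntzAlgebra n →ₗ[ℂ] CuntzAlgebra n where
  toFun a := (M : ℂ)⁻¹ • ∑ w ∈ wordsBetween n M (2 * M), ∑ v ∈ wordsBetween n M (2 * M),
    coeff (w ++ₛ x) (v ++ₛ x) a • (word w * star (word v))
  map_add' a b := by
    simp only [map_add, add_smul, Finset.sum_add_distrib, smul_add]
  map_smul' c a := by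
    simp only [map_smul, smul_eq_mul, mul_smul, ← Finset.smul_sum, RingHom.id_apply]
    rw [smul_comm]

theorem average_apply (x : Stream' (Fin n)) (M : ℕ) (a : CuntzAlgebra n) :
    average x M a = (M : ℂ)⁻¹ • ∑ w ∈ wordsBetween n M (2 * M),
      ∑ v ∈ wordsBetween n M (2 * M), coeff (w ++ₛ x) (v ++ₛ x) a • (word w * star (word v)) := rfl

theorem inv_natCast_smul_nonneg {a : CuntzAlgebra n} (ha : 0 ≤ a) (M : ℕ) :
    0 ≤ (M : ℂ)⁻¹ • a := by
  have : ((M : ℂ)⁻¹ : ℂ) = (((M : ℝ)⁻¹ : ℝ) : ℂ) := by push_cast; rfl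
  rw [this, Complex.coe_smul]
  exact smul_nonneg (by positivity) ha

theorem average_nonneg (x : Stream' (Fin n)) (M : ℕ) {a : CuntzAlgebra n} (ha : 0 ≤ a) :
    0 ≤ average x M a := by
  rw [average_apply]
  refine inv_natCast_smul_nonneg ?_ M
  obtain ⟨b, rfl⟩ := CStarAlgebra.nonneg_iff_eq_star_mul_self.1 ha
  have h := sum_smul_mul_star_nonneg (fun w : wordsBetween n M (2 * M) => word (w : List (Fin n)))
    (Matrix.posSemidef_gram ℂ fun w : wordsBetween n M (2 * M) =>
      permRep n b (basisVec ((w : List (Fin n)) ++ₛ x)))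
  rw [← Finset.sum_coe_sort]
  simp_rw [← Finset.sum_coe_sort (wordsBetween n M (2 * M))]
  convert h using 5
  rw [Matrix.gram_apply, coeff_apply, permRep_mul_apply, inner_permRep, star_star]

theorem average_star (x : Stream' (Fin n)) (M : ℕ) (a : CuntzAlgebra n) :
    average x M (star a) = star (average x M a) := by
  rw [average_apply, average_apply, star_smul, star_sum, Finset.sum_comm]
  simp_rw [star_sum, star_smul, star_mul, star_star, ← coeff_star]
  simp

/-- The average over aperiodic base points is exact, up to a scalar close to `1`, on `S_v S_w^*`. -/
theorem average_word {x : Stream' (Fin n)} (hx : IsAperiodic x) {M : ℕ} {v w : List (Fin n)}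
    (hv : v.length ≤ M) (hw : w.length ≤ M) :
    average x M (word v * star (word w)) =
      ((M : ℂ)⁻¹ * ((2 * M - max v.length w.length - (M - min v.length w.length) : ℕ) : ℂ)) •
        (word v * star (word w)) := by
  rw [average_apply, mul_smul]
  congr 1
  rw [← Finset.sum_product' (f := fun w' v' => coeff (w' ++ₛ x) (v' ++ₛ x)
    (word v * star (word w)) • (word w' * star (word v')))]
  rw [← Finset.sum_of_injOn (s := wordsBetween n (M - min v.length w.length)
      (2 * M - max v.length w.length)) (f := fun u => word v * cyl u * star (word w))
    (fun u => (v ++ u, w ++ u))]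
  · rw [← Finset.sum_mul, ← Finset.mul_sum, sum_cyl_wordsBetween]
    simp
  · intro u _ u' _ h
    simpa using h
  · intro u hu
    simp only [Finset.coe_product, Set.mem_prod, Finset.mem_coe, mem_wordsBetween,
      List.length_append] at hu ⊢
    omega
  · rintro ⟨w', v'⟩ h h'
    simp only [Finset.mem_product, mem_wordsBetween] at h
    rw [coeff_word_eq_zero, zero_smul]
    intro z h1 h2
    change w' ++ₛ x = v ++ₛ z at h1
    -- Since `w'` is at least as long as `v`, the word `z` is `u x` with `w' = v u`.
    obtain ⟨u, rfl⟩ : ∃ u, w' = v ++ u := by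
      have h3 := h1
      rw [← List.take_append_drop v.length w', Stream'.append_append_stream] at h3
      have h4 := append_stream_inj (by simp; omega) h3
      exact ⟨w'.drop v.length, (List.take_append_drop v.length w').symm.trans (by rw [h4])⟩
    have hz : z = u ++ₛ x := by
      have := congrArg (Stream'.drop v.length) h1
      rw [Stream'.append_append_stream, Stream'.drop_append_stream,
        Stream'.drop_append_stream] at this
      exact this.symm
    have hv' : v' = w ++ u := hx.append_inj (by rw [h2, hz, Stream'.append_append_stream])
    apply h'
    refine ⟨u, ?_, by rw [hv']⟩
    rw [hv'] at h
    simp only [List.length_append, Finset.mem_coe, mem_wordsBetween] at h ⊢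
    omega
  · intro u _
    simp only [Stream'.append_append_stream, coeff_append_append, one_smul, word_append, cyl,
      star_mul, mul_assoc]

open Filter Topology in
theorem tendsto_average_of_mem_wordSpan {x : Stream' (Fin n)} (hx : IsAperiodic x)
    {y : CuntzAlgebra n} (hy : y ∈ wordSpan n) :
    Tendsto (fun M => average x M y) atTop (𝓝 y) := by
  induction hy using Submodule.span_induction with
  | mem y hy =>
    obtain ⟨⟨v, w⟩, rfl⟩ := hy
    set p := v.length
    set q := w.length
    have h1 : Tendsto (fun M : ℕ => (1 : ℂ) - (M : ℂ)⁻¹ * ((max p q : ℕ) - (min p q : ℕ) : ℂ))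
        atTop (𝓝 1) := by
      have := ((tendsto_inv_atTop_nhds_zero_nat (𝕜 := ℂ)).mul_const
        ((max p q : ℕ) - (min p q : ℕ) : ℂ)).const_sub 1
      simpa using this
    have h2 := h1.smul_const (word v * star (word w))
    rw [one_smul] at h2
    refine h2.congr' ?_
    filter_upwards [eventually_ge_atTop (p + q + 1)] with M hM
    rw [average_word hx (by omega) (by omega)]
    congr 1
    have hM0 : (M : ℂ) ≠ 0 := Nat.cast_ne_zero.2 (by omega)
    have h3 : 2 * M - max p q - (M - min p q) + max p q = M + min p q := by omega
    have h4 := congrArg (Nat.cast (R := ℂ)) h3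
    push_cast at h4 ⊢
    field_simp
    linear_combination -h4
  | zero => simp
  | add a b _ _ ha hb => simpa using ha.add hb
  | smul c a _ ha => simpa using ha.const_smul c

theorem average_one {x : Stream' (Fin n)} (hx : IsAperiodic x) {M : ℕ} (hM : M ≠ 0) :
    average x M 1 = 1 := by
  have := average_word hx (M := M) (v := []) (w := []) (by simp) (by simp)
  have hM0 : (M : ℂ) ≠ 0 := Nat.cast_ne_zero.2 hM
  simp only [word_nil, star_one, mul_one, List.length_nil, max_self, min_self] at this
  rw [this, show 2 * M - 0 - (M - 0) = M by omega, inv_mul_cancel₀ hM0, one_smul]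

theorem average_algebraMap {x : Stream' (Fin n)} (hx : IsAperiodic x) {M : ℕ} (hM : M ≠ 0)
    (r : ℝ) :
    average x M (algebraMap ℝ _ r) = algebraMap ℝ _ r := by
  rw [Algebra.algebraMap_eq_smul_one, ← Complex.coe_smul, map_smul, average_one hx hM]

theorem norm_average_le {x : Stream' (Fin n)} (hx : IsAperiodic x) {M : ℕ} (hM : M ≠ 0)
    {a : CuntzAlgebra n} (ha : IsSelfAdjoint a) : ‖average x M a‖ ≤ ‖a‖ := by
  refine norm_le_of_neg_le_of_le ?_ (norm_nonneg a) ?_ ?_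
  · rw [IsSelfAdjoint, ← average_star, ha.star_eq]
  · have := average_nonneg x M (a := a + algebraMap ℝ _ ‖a‖)
      (neg_le_iff_add_nonneg.1 ha.neg_algebraMap_norm_le_self)
    rwa [map_add, average_algebraMap hx hM, ← neg_le_iff_add_nonneg] at this
  · have := average_nonneg x M (sub_nonneg.2 ha.le_algebraMap_norm_self)
    rwa [map_sub, average_algebraMap hx hM, sub_nonneg] at this

theorem exists_wordSpan_isSelfAdjoint_norm_sub_lt {a : CuntzAlgebra n} (ha : IsSelfAdjoint a)
    {ε : ℝ} (hε : 0 < ε) : ∃ y ∈ wordSpan n, IsSelfAdjoint y ∧ ‖a - y‖ < ε := by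
  obtain ⟨y, hy, hay⟩ := exists_wordSpan_norm_sub_lt a hε
  refine ⟨realPart y, ?_, (realPart y).2, ?_⟩
  · rw [realPart_apply_coe, ← Complex.coe_smul]
    exact Submodule.smul_mem _ _ (Submodule.add_mem _ hy (wordSpan_star_mem hy))
  · have h := realPart.norm_le (a - y)
    rw [map_sub] at h
    have h1 : a - (realPart y : CuntzAlgebra n) = ↑(realPart a - realPart y) := by
      rw [AddSubgroupClass.coe_sub, ha.coe_realPart]
    rw [h1]
    exact lt_of_le_of_lt h hay

open Filter Topology in
theorem tendsto_average {x : Stream' (Fin n)} (hx : IsAperiodic x) {a : CuntzAlgebra n}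
    (ha : IsSelfAdjoint a) : Tendsto (fun M => average x M a) atTop (𝓝 a) := by
  rw [Metric.tendsto_atTop]
  intro ε hε
  obtain ⟨y, hy, hys, hay⟩ :=
    exists_wordSpan_isSelfAdjoint_norm_sub_lt ha (show 0 < ε / 3 by linarith)
  obtain ⟨N, hN⟩ := Metric.tendsto_atTop.1 (tendsto_average_of_mem_wordSpan hx hy) (ε / 3)
    (by linarith)
  refine ⟨N + 1, fun M hM => ?_⟩
  have h1 := hN M (by omega)
  have h2 := norm_average_le hx (show M ≠ 0 by omega) (ha.sub hys)
  rw [dist_eq_norm] at h1 ⊢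
  have h3 : average x M a - a = average x M (a - y) + (average x M y - y) - (a - y) := by
    rw [map_sub]; abel
  rw [h3]
  have h4 := norm_sub_le (average x M (a - y) + (average x M y - y)) (a - y)
  have h5 := norm_add_le (average x M (a - y)) (average x M y - y)
  linarith

/-- A self-adjoint element that acts diagonally on `ℓ²(X)` is bounded by its diagonal matrix
coefficients at the words that end in a given aperiodic word. -/
theorem norm_le_of_coeff_self_le_of_isSelfAdjoint {x : Stream' (Fin n)} (hx : IsAperiodic x)
    {a : CuntzAlgebra n} (ha : IsSelfAdjoint a) (hc : ∀ w, cyl w * a = a * cyl w)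
    {ε : ℝ} (hε : 0 ≤ ε) (h : ∀ w : List (Fin n), ‖coeff (w ++ₛ x) (w ++ₛ x) a‖ ≤ ε) :
    ‖a‖ ≤ ε := by
  refine le_of_tendsto (tendsto_average hx ha).norm ?_
  filter_upwards [Filter.eventually_ne_atTop 0] with M hM
  have havg : ∀ b : CuntzAlgebra n, (∀ w, cyl w * b = b * cyl w) →
      (∀ w : List (Fin n), ∃ r : ℝ, 0 ≤ r ∧ coeff (w ++ₛ x) (w ++ₛ x) b = r) →
      0 ≤ average x M b := by
    intro b hb hpos
    rw [average_apply]
    refine inv_natCast_smul_nonneg (Finset.sum_nonneg fun w _ => Finset.sum_nonneg fun v _ => ?_) M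
    by_cases hwv : w = v
    · subst hwv
      obtain ⟨r, hr, hr'⟩ := hpos w
      rw [hr', Complex.coe_smul]
      exact smul_nonneg hr (mul_star_self_nonneg _)
    · rw [coeff_eq_zero_of_commute hb fun h => hwv (hx.append_inj h), zero_smul]
  have hreal : ∀ w : List (Fin n), ∃ r : ℝ, |r| ≤ ε ∧ coeff (w ++ₛ x) (w ++ₛ x) a = r := by
    intro w
    have h1 := coeff_star (w ++ₛ x) (w ++ₛ x) a
    rw [ha.star_eq] at h1
    obtain ⟨r, hr⟩ := Complex.conj_eq_iff_real.1 h1.symm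
    refine ⟨r, ?_, hr⟩
    have h2 := h w
    rwa [hr, Complex.norm_real] at h2
  have hcoeff : ∀ w : List (Fin n), coeff (w ++ₛ x) (w ++ₛ x) (algebraMap ℝ _ ε) = (ε : ℂ) := by
    intro w
    rw [Algebra.algebraMap_eq_smul_one, ← Complex.coe_smul, map_smul, coeff_one_self,
      smul_eq_mul, mul_one]
  have hcomm : ∀ w, cyl w * algebraMap ℝ (CuntzAlgebra n) ε = algebraMap ℝ _ ε * cyl w :=
    fun w => (Algebra.commutes _ _).symm
  refine norm_le_of_neg_le_of_le ?_ hε ?_ ?_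
  · rw [IsSelfAdjoint, ← average_star, ha.star_eq]
  · have := havg (a + algebraMap ℝ _ ε) (fun w => by rw [mul_add, add_mul, hc, hcomm]) fun w => by
      obtain ⟨r, hr, hr'⟩ := hreal w
      exact ⟨r + ε, by linarith [neg_abs_le r],
        by rw [map_add, hcoeff, hr', Complex.ofReal_add]⟩
    rwa [map_add, average_algebraMap hx hM, ← neg_le_iff_add_nonneg] at this
  · have := havg (algebraMap ℝ _ ε - a) (fun w => by rw [mul_sub, sub_mul, hc, hcomm]) fun w => by
      obtain ⟨r, hr, hr'⟩ := hreal w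
      exact ⟨ε - r, by linarith [le_abs_self r],
        by rw [map_sub, hcoeff, hr', Complex.ofReal_sub]⟩
    rwa [map_sub, average_algebraMap hx hM, sub_nonneg] at this

/-- The general case of `norm_le_of_coeff_self_le_of_isSelfAdjoint`; the factor `2` stems from the
decomposition into real and imaginary parts. -/
theorem norm_le_of_coeff_self_le {x : Stream' (Fin n)} (hx : IsAperiodic x)
    {a : CuntzAlgebra n} (hc : ∀ w, cyl w * a = a * cyl w)
    {ε : ℝ} (hε : 0 ≤ ε) (h : ∀ w : List (Fin n), ‖coeff (w ++ₛ x) (w ++ₛ x) a‖ ≤ ε) :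
    ‖a‖ ≤ 2 * ε := by
  have hc' : ∀ w, cyl w * star a = star a * cyl w := fun w => by
    have := congrArg star (hc w)
    rw [star_mul, star_mul, star_cyl] at this
    exact this.symm
  have hre : ∀ b : CuntzAlgebra n, (∀ w, cyl w * b = b * cyl w) →
      (∀ w, cyl w * star b = star b * cyl w) →
      (∀ w : List (Fin n), ‖coeff (w ++ₛ x) (w ++ₛ x) b‖ ≤ ε) →
      ‖(realPart b : CuntzAlgebra n)‖ ≤ ε := by
    intro b hb hb' hbε
    refine norm_le_of_coeff_self_le_of_isSelfAdjoint hx (realPart b).2 (fun w => ?_) hε fun w => ?_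
    · rw [realPart_apply_coe, mul_smul_comm, smul_mul_assoc, mul_add, add_mul, hb, hb']
    · rw [realPart_apply_coe, ← Complex.coe_smul, map_smul, map_add, coeff_star, norm_smul]
      have h1 := norm_add_le (coeff (w ++ₛ x) (w ++ₛ x) b) (star (coeff (w ++ₛ x) (w ++ₛ x) b))
      rw [norm_star] at h1
      have h2 : ‖(((2 : ℝ)⁻¹ : ℝ) : ℂ)‖ = 2⁻¹ := by simp
      rw [h2]
      linarith [hbε w]
  have h1 := hre a hc hc' h
  have h2 := hre (-Complex.I • a) (fun w => by rw [mul_smul_comm, smul_mul_assoc, hc])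
    (fun w => by rw [star_smul, mul_smul_comm, smul_mul_assoc, hc']) fun w => by
      rw [map_smul, norm_smul]; simpa using h w
  have h3 : a = (realPart a : CuntzAlgebra n) +
      Complex.I • (realPart (-Complex.I • a) : CuntzAlgebra n) := by
    have := realPart_add_I_smul_imaginaryPart a
    rw [realPart_smul]
    simpa using this.symm
  rw [h3]
  refine (norm_add_le _ _).trans ?_
  rw [norm_smul, Complex.norm_I, one_mul]
  linarith

end SpectralOrder

/-! ### The diagonal is maximal abelian -/

theorem exists_mem_diagonal_coeff_self_eq {y : CuntzAlgebra n} (hy : y ∈ wordSpan n) :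
    ∃ d ∈ diagonal n, ∀ x : Stream' (Fin n), IsAperiodic x → coeff x x d = coeff x x y := by
  induction hy using Submodule.span_induction with
  | mem y hy =>
    obtain ⟨⟨v, w⟩, rfl⟩ := hy
    by_cases hvw : v = w
    · subst hvw
      exact ⟨cyl v, cyl_mem_diagonal v, fun x _ => rfl⟩
    · exact ⟨0, zero_mem _, fun x hx => by rw [hx.coeff_eq_zero hvw, map_zero]⟩
  | zero => exact ⟨0, zero_mem _, fun x _ => rfl⟩
  | add y z _ _ hy hz =>
    obtain ⟨d, hd, hdy⟩ := hy
    obtain ⟨e, he, hez⟩ := hz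
    exact ⟨d + e, add_mem hd he, fun x hx => by rw [map_add, map_add, hdy x hx, hez x hx]⟩
  | smul c y _ hy =>
    obtain ⟨d, hd, hdy⟩ := hy
    exact ⟨c • d, (diagonal n).smul_mem hd c, fun x hx => by rw [map_smul, map_smul, hdy x hx]⟩

/-- The diagonal is a maximal abelian subalgebra. -/
theorem mem_diagonal_of_commute (hn : 2 ≤ n) {a : CuntzAlgebra n}
    (ha : ∀ w, cyl w * a = a * cyl w) : a ∈ diagonal n := by
  obtain ⟨x, hx⟩ := exists_isAperiodic hn
  rw [← SetLike.mem_coe, ← (isClosed_diagonal n).closure_eq, Metric.mem_closure_iff]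
  intro ε hε
  obtain ⟨y, hy, hay⟩ := exists_wordSpan_norm_sub_lt a (show 0 < ε / 3 by linarith)
  obtain ⟨d, hd, hdy⟩ := exists_mem_diagonal_coeff_self_eq hy
  refine ⟨d, hd, ?_⟩
  have h1 : ‖a - d‖ ≤ 2 * (ε / 3) := by
    refine norm_le_of_coeff_self_le hx (fun w => ?_) (by linarith) fun w => ?_
    · rw [mul_sub, sub_mul, ha, diagonal_comm hd (cyl_mem_diagonal w)]
    · rw [map_sub, hdy _ (hx.append w), ← map_sub]
      exact (norm_coeff_le _ _ _).trans hay.le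
  rw [dist_eq_norm]
  linarith

/-! ### Endomorphisms that fix the diagonal -/

theorem bijective_of_comp_eq_one {δ η : CuntzAlgebra n →⋆ₐ[ℂ] CuntzAlgebra n} (h1 : η * δ = 1)
    (h2 : δ * η = 1) : Function.Bijective δ :=
  Function.bijective_iff_has_inverse.2 ⟨η, DFunLike.congr_fun h1, DFunLike.congr_fun h2⟩

/-- An endomorphism that fixes the diagonal pointwise is an automorphism: it maps `S_i` to
`S_i v_i` for a unitary `v_i = S_i^* δ(S_i)` that commutes with the diagonal and hence belongs to
it, so that `S_i ↦ S_i v_i^*` defines an inverse. -/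
theorem bijective_of_fixes_diagonal (hn : 2 ≤ n) (δ : CuntzAlgebra n →⋆ₐ[ℂ] CuntzAlgebra n)
    (hδ : ∀ d ∈ diagonal n, δ d = d) : Function.Bijective δ := by
  obtain ⟨v, hv⟩ : ∃ v : Fin n → CuntzAlgebra n, ∀ i, v i = star (S n i) * δ (S n i) :=
    ⟨_, fun _ => rfl⟩
  have hSS : ∀ i, star (S n i) * S n i = 1 := (isCuntzFamily_S n).isometry
  have hδδ : ∀ i, star (δ (S n i)) * δ (S n i) = 1 := fun i => by
    rw [← map_star, ← map_mul, hSS, map_one]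
  -- The isometries `S_i` and `δ(S_i)` have the same range projection.
  have hrange : ∀ i, δ (S n i) * star (δ (S n i)) = S n i * star (S n i) := fun i => by
    have := hδ _ (cyl_mem_diagonal [i])
    simpa [cyl, word_cons, map_star] using this
  have hδS : ∀ i, δ (S n i) = S n i * v i := fun i => by
    rw [hv, ← mul_assoc, ← hrange, mul_assoc, hδδ, mul_one]
  have hvv : ∀ i, star (v i) * v i = 1 := fun i => by
    have := hδδ i
    rwa [hδS, star_mul, mul_assoc, ← mul_assoc (star (S n i)), hSS, one_mul] at this
  have hvv' : ∀ i, v i * star (v i) = 1 := fun i => by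
    have : v i * star (v i) = star (S n i) * (δ (S n i) * star (δ (S n i))) * S n i := by
      simp only [hv, star_mul, star_star, mul_assoc]
    rw [this, hrange, ← mul_assoc, hSS, one_mul, hSS]
  have hvc : ∀ i w, cyl w * v i = v i * cyl w := fun i w => by
    have h1 : δ (S n i) * cyl w * star (δ (S n i)) = S n i * cyl w * star (S n i) := by
      have := hδ _ (cyl_mem_diagonal (i :: w))
      rwa [cyl_cons, map_mul, map_mul, map_star, hδ _ (cyl_mem_diagonal w)] at this
    calc cyl w * v i = star (S n i) * (S n i * cyl w * star (S n i)) * δ (S n i) := by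
          rw [← mul_assoc, ← mul_assoc, hSS, one_mul, mul_assoc, ← hv]
      _ = v i * cyl w := by
          rw [← h1, mul_assoc, mul_assoc _ _ (δ (S n i)), hδδ, mul_one, ← mul_assoc, ← hv]
  have hvD : ∀ i, v i ∈ diagonal n := fun i => mem_diagonal_of_commute hn (hvc i)
  have hT : IsCuntzFamily fun i => S n i * star (v i) :=
    { isometry := fun i => by
        rw [star_mul, star_star, mul_assoc, ← mul_assoc (star (S n i)), hSS, one_mul, hvv']
      sum_range := by
        rw [← (isCuntzFamily_S n).sum_range]
        refine Finset.sum_congr rfl fun i _ => ?_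
        rw [star_mul, star_star, mul_assoc, ← mul_assoc (star (v i)), hvv, one_mul] }
  obtain ⟨η, hη, -⟩ := existsUnique_lift hT
  have hηcyl : ∀ w, η (cyl w) = cyl w := by
    intro w
    induction w with
    | nil => rw [cyl_nil, map_one]
    | cons i w ih =>
      have h1 : star (v i) * cyl w * v i = cyl w := by
        rw [mul_assoc, hvc, ← mul_assoc, hvv, one_mul]
      rw [cyl_cons, map_mul, map_mul, map_star, ih, hη, star_mul, star_star]
      conv_rhs => rw [← h1]
      simp only [mul_assoc]
  have hηD : ∀ d ∈ diagonal n, η d = d := fun d hd =>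
    eqOn_diagonal (φ := η) (ψ := StarAlgHom.id ℂ _) hηcyl hd
  refine bijective_of_comp_eq_one (η := η) (hom_ext fun i => ?_) (hom_ext fun i => ?_)
  · change η (δ (S n i)) = S n i
    rw [hδS, map_mul, hη, hηD _ (hvD i), mul_assoc, hvv, mul_one]
  · change δ (η (S n i)) = S n i
    rw [hη, map_mul, map_star, hδ _ (hvD i), hδS, mul_assoc, hvv', mul_one]

/-! ### Consequences for the restriction map -/

theorem Extends.bijective_of_one (hn : 2 ≤ n) {δ : CuntzAlgebra n →⋆ₐ[ℂ] CuntzAlgebra n}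
    (h : Extends δ 1) : Function.Bijective δ :=
  bijective_of_fixes_diagonal hn δ fun d hd => h ⟨d, hd⟩

theorem Extends.inv {γ : CuntzAlgebra n ≃⋆ₐ[ℂ] CuntzAlgebra n} {α : diagonal n ≃⋆ₐ[ℂ] diagonal n}
    (h : Extends (γ : CuntzAlgebra n →⋆ₐ[ℂ] CuntzAlgebra n) α) :
    Extends ((γ⁻¹ : CuntzAlgebra n ≃⋆ₐ[ℂ] CuntzAlgebra n) : CuntzAlgebra n →⋆ₐ[ℂ] CuntzAlgebra n)
      α⁻¹ := by
  intro x
  have h1 := h (α⁻¹ x)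
  have h2 : α (α⁻¹ x) = x := α.apply_symm_apply x
  rw [h2] at h1
  rw [← h1]
  exact γ.symm_apply_apply _

/-- If an automorphism of the diagonal and its inverse extend to endomorphisms, then these are
automorphisms. -/
theorem Extends.bijective_of_inv (hn : 2 ≤ n) {γ δ : CuntzAlgebra n →⋆ₐ[ℂ] CuntzAlgebra n}
    {α : diagonal n ≃⋆ₐ[ℂ] diagonal n} (h : Extends γ α) (k : Extends δ α⁻¹) :
    Function.Bijective γ := by
  have h1 : Function.Bijective (γ ∘ δ) :=
    Extends.bijective_of_one hn (δ := γ * δ) (by simpa using h.mul k)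
  have h2 : Function.Bijective (δ ∘ γ) :=
    Extends.bijective_of_one hn (δ := δ * γ) (by simpa using k.mul h)
  exact ⟨h2.1.of_comp, h1.2.of_comp⟩

theorem exists_starAlgEquiv_coe_eq {γ : CuntzAlgebra n →⋆ₐ[ℂ] CuntzAlgebra n}
    (h : Function.Bijective γ) :
    ∃ θ : CuntzAlgebra n ≃⋆ₐ[ℂ] CuntzAlgebra n, (θ : CuntzAlgebra n →⋆ₐ[ℂ] CuntzAlgebra n) = γ :=
  ⟨StarAlgEquiv.ofBijective γ h, StarAlgHom.ext fun _ => rfl⟩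

/-- If an automorphism of the diagonal extends to an automorphism, then all its extensions are
automorphisms. -/
theorem Extends.bijective_of_starAlgEquiv (hn : 2 ≤ n)
    {γ : CuntzAlgebra n →⋆ₐ[ℂ] CuntzAlgebra n} {θ : CuntzAlgebra n ≃⋆ₐ[ℂ] CuntzAlgebra n}
    {α : diagonal n ≃⋆ₐ[ℂ] diagonal n} (h : Extends γ α)
    (k : Extends (θ : CuntzAlgebra n →⋆ₐ[ℂ] CuntzAlgebra n) α) : Function.Bijective γ :=
  h.bijective_of_inv hn k.inv

/-- A product of proper endomorphisms that restrict to automorphisms of the diagonal is proper. -/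
theorem Extends.isProper_mul (hn : 2 ≤ n) {γ δ : CuntzAlgebra n →⋆ₐ[ℂ] CuntzAlgebra n}
    {α β : diagonal n ≃⋆ₐ[ℂ] diagonal n} (h : Extends γ α) (k : Extends δ β) (hγ : IsProper γ) :
    IsProper (γ * δ) := by
  intro hbij
  obtain ⟨θ, hθ⟩ := exists_starAlgEquiv_coe_eq hbij
  have h1 : Extends (θ : CuntzAlgebra n →⋆ₐ[ℂ] CuntzAlgebra n) (α * β) := hθ ▸ h.mul k
  have h2 := k.mul h1.inv
  rw [mul_inv_rev, mul_inv_cancel_left] at h2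
  exact hγ (h.bijective_of_inv hn h2)

/-! ### Injectivity on the diagonal -/

/-- An element of the `*`-algebra generated by the cylinder projections is constant on a small
enough cylinder around a given infinite word `x`. -/
theorem exists_mul_cyl_take_eq_smul {d : CuntzAlgebra n}
    (hd : d ∈ StarAlgebra.adjoin ℂ (Set.range fun α : List (Fin n) => word α * star (word α)))
    (x : Stream' (Fin n)) : ∃ (c : ℂ) (k : ℕ), ∀ j, k ≤ j →
      d * cyl (x.take j) = c • cyl (x.take j) ∧ cyl (x.take j) * d = c • cyl (x.take j) := by
  induction hd using StarAlgebra.adjoin_induction with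
  | mem d hd =>
    obtain ⟨w, rfl⟩ := hd
    change ∃ (c : ℂ) (k : ℕ), ∀ j, k ≤ j → cyl w * cyl (x.take j) = c • cyl (x.take j) ∧
      cyl (x.take j) * cyl w = c • cyl (x.take j)
    simp_rw [cyl_comm _ w, and_self]
    have htake : ∀ j, w.length ≤ j → ∃ t, x.take j = x.take w.length ++ t := fun j hj => by
      obtain ⟨t, ht⟩ := Stream'.take_prefix_take_left _ _ x hj
      exact ⟨t, ht.symm⟩
    by_cases hw : w = x.take w.length
    · refine ⟨1, w.length, fun j hj => ?_⟩
      obtain ⟨t, ht⟩ := htake j hj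
      rw [ht, ← hw, cyl_mul_cyl_append, one_smul]
    · refine ⟨0, w.length, fun j hj => ?_⟩
      obtain ⟨t, ht⟩ := htake j hj
      have h0 : cyl w * cyl (x.take w.length) = 0 := by
        refine cyl_mul_cyl_of_eq_zero ?_
        rcases star_word_mul_word w (x.take w.length) with ⟨t, h, -⟩ | ⟨t, h, -⟩ | h
        · have hl := congrArg List.length h
          simp only [Stream'.length_take, List.length_append, left_eq_add,
            List.length_eq_zero_iff] at hl
          rw [hl, List.append_nil] at h
          exact absurd h.symm hw
        · have hl := congrArg List.length h
          simp only [Stream'.length_take, List.length_append, left_eq_add,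
            List.length_eq_zero_iff] at hl
          rw [hl, List.append_nil] at h
          exact absurd h hw
        · exact h
      rw [ht, ← cyl_mul_cyl_append, ← mul_assoc, h0, zero_mul, zero_smul]
  | algebraMap r =>
    refine ⟨r, 0, fun j _ => ?_⟩
    rw [Algebra.algebraMap_eq_smul_one, smul_mul_assoc, mul_smul_comm, one_mul, mul_one]
    exact ⟨rfl, rfl⟩
  | add d e _ _ hd he =>
    obtain ⟨b, k, hb⟩ := hd
    obtain ⟨c, l, hc⟩ := he
    refine ⟨b + c, max k l, fun j hj => ?_⟩
    obtain ⟨hb1, hb2⟩ := hb j (le_of_max_le_left hj)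
    obtain ⟨hc1, hc2⟩ := hc j (le_of_max_le_right hj)
    rw [add_mul, mul_add, hb1, hb2, hc1, hc2, add_smul]
    exact ⟨rfl, rfl⟩
  | mul d e _ _ hd he =>
    obtain ⟨b, k, hb⟩ := hd
    obtain ⟨c, l, hc⟩ := he
    refine ⟨b * c, max k l, fun j hj => ?_⟩
    obtain ⟨hb1, hb2⟩ := hb j (le_of_max_le_left hj)
    obtain ⟨hc1, hc2⟩ := hc j (le_of_max_le_right hj)
    rw [mul_assoc, hc1, mul_smul_comm, hb1, ← mul_assoc, hb2, smul_mul_assoc, hc2, smul_smul,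
      smul_smul, mul_comm c b]
    exact ⟨rfl, rfl⟩
  | star d _ hd =>
    obtain ⟨c, k, hc⟩ := hd
    refine ⟨star c, k, fun j hj => ?_⟩
    obtain ⟨hc1, hc2⟩ := hc j hj
    have h1 := congrArg star hc1
    have h2 := congrArg star hc2
    rw [star_mul, star_smul, star_cyl] at h1 h2
    exact ⟨h2, h1⟩

/-- A unital `*`-homomorphism from `𝒪_n` to a nonzero C*-algebra is injective on the diagonal. -/
theorem eq_zero_of_mem_diagonal_of_map_eq_zero (hn : 2 ≤ n) {B : Type*} [CStarAlgebra B]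
    [Nontrivial B] (φ : CuntzAlgebra n →⋆ₐ[ℂ] B) {d : CuntzAlgebra n} (hd : d ∈ diagonal n)
    (hφ : φ d = 0) : d = 0 := by
  obtain ⟨x, hx⟩ := exists_isAperiodic hn
  have h0 : ∀ y : Stream' (Fin n), ‖coeff y y d‖ ≤ 0 := by
    intro y
    refine le_of_forall_pos_le_add fun ε hε => ?_
    obtain ⟨e, he, hde⟩ := Metric.mem_closure_iff.1 hd (ε / 2) (by linarith)
    rw [dist_eq_norm] at hde
    obtain ⟨c, k, hc⟩ := exists_mul_cyl_take_eq_smul he y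
    have hck := (hc k le_rfl).1
    have hy := permRep_cyl_basisVec (y.take k) (y.drop k)
    rw [Stream'.append_take_drop] at hy
    have hcoeff : coeff y y e = c := by
      rw [coeff_apply, ← hy, ← permRep_mul_apply, hck, map_smul]
      change inner ℂ _ (c • permRep n _ _) = c
      rw [hy, inner_smul_right, inner_basisVec_self, mul_one]
    have hne : φ (cyl (y.take k)) ≠ 0 := by
      intro h
      have h1 : star (word (y.take k)) * cyl (y.take k) * word (y.take k) = 1 := by
        rw [cyl, ← mul_assoc, star_word_mul_self, one_mul, star_word_mul_self]
      have h2 := congrArg φ h1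
      rw [map_mul, map_mul, h, mul_zero, zero_mul, map_one] at h2
      exact zero_ne_one h2
    have hφe : ‖φ e‖ ≤ ‖d - e‖ := by
      have := NonUnitalStarAlgHom.norm_apply_le φ (d - e)
      rwa [map_sub, hφ, zero_sub, norm_neg] at this
    have hcφ : ‖c‖ ≤ ‖φ e‖ := by
      have h1 := norm_mul_le (φ e) (φ (cyl (y.take k)))
      rw [← map_mul, hck, map_smul, norm_smul] at h1
      exact le_of_mul_le_mul_right h1 (norm_pos_iff.2 hne)
    have h1 := norm_coeff_le y y (d - e)
    rw [map_sub, hcoeff] at h1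
    have h2 := norm_le_norm_sub_add (coeff y y d) c
    linarith
  have := norm_le_of_coeff_self_le hx (fun w => diagonal_comm hd (cyl_mem_diagonal w)) le_rfl
    fun w => h0 (w ++ₛ x)
  rw [mul_zero] at this
  exact norm_le_zero_iff.1 this

/-- An endomorphism restricts to an automorphism of the diagonal if all cylinder projections are
images of elements of the diagonal: the image of the diagonal is then an abelian algebra that
contains the diagonal, hence equal to it by maximality. -/
theorem exists_extends_of_cyl_mem_map (hn : 2 ≤ n) (γ : CuntzAlgebra n →⋆ₐ[ℂ] CuntzAlgebra n)
    (h : ∀ w, ∃ d ∈ diagonal n, γ d = cyl w) :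
    ∃ α : diagonal n ≃⋆ₐ[ℂ] diagonal n, Extends γ α := by
  have : NeZero n := ⟨by omega⟩
  have hcl := isClosed_diagonal n
  have hmaps : ∀ d ∈ diagonal n, γ d ∈ diagonal n := by
    intro d hd
    refine mem_diagonal_of_commute hn fun w => ?_
    obtain ⟨e, he, hew⟩ := h w
    rw [← hew, ← map_mul, ← map_mul, diagonal_comm hd he]
  let f : diagonal n →⋆ₐ[ℂ] diagonal n :=
    (γ.comp (diagonal n).subtype).codRestrict (diagonal n) fun d => hmaps d d.2
  have hf : ∀ d : diagonal n, (f d : CuntzAlgebra n) = γ d := fun _ => rfl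
  have hinj : Function.Injective f := by
    refine (injective_iff_map_eq_zero f).2 fun d hd => Subtype.ext ?_
    exact eq_zero_of_mem_diagonal_of_map_eq_zero hn γ d.2 (congrArg Subtype.val hd)
  have hsurj : Function.Surjective f := by
    let g : diagonal n →⋆ₐ[ℂ] CuntzAlgebra n := γ.comp (diagonal n).subtype
    have hg : Function.Injective g := fun c d hcd => hinj (Subtype.ext hcd)
    have hiso : Isometry g := NonUnitalStarAlgHom.isometry g hg
    have hle : diagonal n ≤ g.range := by
      refine diagonal_le ?_ fun w => ?_
      · exact hiso.isClosedEmbedding.isClosed_range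
      · obtain ⟨d, hd, hdw⟩ := h w
        exact ⟨⟨d, hd⟩, hdw⟩
    intro d
    obtain ⟨c, hc⟩ := hle d.2
    exact ⟨c, Subtype.ext hc⟩
  exact ⟨StarAlgEquiv.ofBijective f ⟨hinj, hsurj⟩, fun d => rfl⟩

/-! ### A proper endomorphism that restricts to an automorphism of the diagonal -/

section Twist

variable {R : Type*} [Ring R] [StarRing R]

/-- For isometries `s`, `t` with orthogonal ranges, a further isometry, with range projection
`ss^* + tt^* - (ss)(ss)^*`. If `s = S_a` and `t = S_b` are among the generators of `𝒪_n`, it maps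
infinite words by
`b z ↦ b b z`, `a a z ↦ a b z`, `a b z ↦ b a z`, `c z ↦ a c z` and `a c z ↦ b c z` for the
other letters `c`. -/
def twist (s t : R) : R :=
  t * t * star t + s * (1 - s * star s - t * star t) +
    (s * t * star s + t * s * star t + t * (1 - s * star s - t * star t)) * star s

variable {s t : R}

theorem twist_mul_right (ht : star t * t = 1) (hst : star s * t = 0) :
    twist s t * t = t * t := by
  simp only [twist, add_mul, mul_sub, sub_mul, mul_assoc, ht, hst, mul_one, mul_zero]
  abel

theorem twist_mul_left (hs : star s * s = 1) (hts : star t * s = 0) :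
    twist s t * s = s * t * star s + t * s * star t + t * (1 - s * star s - t * star t) := by
  simp only [twist, add_mul, mul_sub, sub_mul, mul_assoc, hs, hts, mul_one, mul_zero]
  abel

theorem twist_mul_left_left (hs : star s * s = 1) (hts : star t * s = 0) :
    twist s t * (s * s) = s * t := by
  rw [← mul_assoc, twist_mul_left hs hts]
  simp only [add_mul, mul_sub, sub_mul, mul_assoc, hs, hts, mul_one, mul_zero]
  abel

theorem twist_mul_left_right (hs : star s * s = 1) (ht : star t * t = 1) (hst : star s * t = 0)
    (hts : star t * s = 0) : twist s t * (s * t) = t * s := by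
  rw [← mul_assoc, twist_mul_left hs hts]
  simp only [add_mul, mul_sub, sub_mul, mul_assoc, ht, hst, mul_one, mul_zero]
  abel

theorem twist_mul_of_orthogonal {u : R} (hsu : star s * u = 0) (htu : star t * u = 0) :
    twist s t * u = s * u := by
  simp only [twist, add_mul, mul_sub, sub_mul, mul_assoc, hsu, htu, mul_one, mul_zero]
  abel

theorem twist_mul_left_of_orthogonal {u : R} (hs : star s * s = 1) (hts : star t * s = 0)
    (hsu : star s * u = 0) (htu : star t * u = 0) : twist s t * (s * u) = t * u := by
  rw [← mul_assoc, twist_mul_left hs hts]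
  simp only [add_mul, mul_sub, sub_mul, mul_assoc, hsu, htu, mul_one, mul_zero]
  abel

theorem star_twist_mul_twist (hs : star s * s = 1) (ht : star t * t = 1) (hst : star s * t = 0)
    (hts : star t * s = 0) : star (twist s t) * twist s t = 1 := by
  have hs' : ∀ x, star s * (s * x) = x := fun x => by rw [← mul_assoc, hs, one_mul]
  have ht' : ∀ x, star t * (t * x) = x := fun x => by rw [← mul_assoc, ht, one_mul]
  have hst' : ∀ x, star s * (t * x) = 0 := fun x => by rw [← mul_assoc, hst, zero_mul]
  have hts' : ∀ x, star t * (s * x) = 0 := fun x => by rw [← mul_assoc, hts, zero_mul]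
  simp only [twist, star_add, star_sub, star_mul, star_star, mul_add, add_mul, mul_sub,
    sub_mul, mul_assoc, mul_one, hs, hts, hs', ht', hst', hts', mul_zero]
  abel

theorem twist_mul_star_twist (hs : star s * s = 1) (ht : star t * t = 1) (hst : star s * t = 0)
    (hts : star t * s = 0) : twist s t * star (twist s t) =
      s * star s + t * star t - s * s * star (s * s) := by
  have hs' : ∀ x, star s * (s * x) = x := fun x => by rw [← mul_assoc, hs, one_mul]
  have ht' : ∀ x, star t * (t * x) = x := fun x => by rw [← mul_assoc, ht, one_mul]
  have hst' : ∀ x, star s * (t * x) = 0 := fun x => by rw [← mul_assoc, hst, zero_mul]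
  have hts' : ∀ x, star t * (s * x) = 0 := fun x => by rw [← mul_assoc, hts, zero_mul]
  simp only [twist, star_add, star_sub, star_mul, star_star, mul_add, add_mul, mul_sub,
    sub_mul, mul_assoc, mul_one, hs', ht', hst', hts', mul_zero]
  abel

/-- The square of `twist s t` has the range projection `tt^*`. -/
theorem twist_conj_twist_mul_star_twist (hs : star s * s = 1) (ht : star t * t = 1)
    (hst : star s * t = 0) (hts : star t * s = 0) :
    twist s t * (twist s t * star (twist s t)) * star (twist s t) = t * star t := by
  have h1 : ∀ p : R, twist s t * (p * star p) * star (twist s t) =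
      twist s t * p * star (twist s t * p) := fun p => by simp only [star_mul, mul_assoc]
  rw [twist_mul_star_twist hs ht hst hts, mul_sub, mul_add, sub_mul, add_mul, h1, h1, h1,
    twist_mul_left_left hs hts, twist_mul_left hs hts, twist_mul_right ht hst]
  have hs' : ∀ x, star s * (s * x) = x := fun x => by rw [← mul_assoc, hs, one_mul]
  have ht' : ∀ x, star t * (t * x) = x := fun x => by rw [← mul_assoc, ht, one_mul]
  have hst' : ∀ x, star s * (t * x) = 0 := fun x => by rw [← mul_assoc, hst, zero_mul]
  have hts' : ∀ x, star t * (s * x) = 0 := fun x => by rw [← mul_assoc, hts, zero_mul]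
  simp only [star_add, star_sub, star_mul, star_star, mul_add, add_mul, mul_sub,
    sub_mul, mul_assoc, mul_one, hs', ht', hst', hts', mul_zero]
  abel

end Twist

/-- The Cuntz family `S_a ↦ S_a^2`, `S_b ↦ twist S_a S_b`, `S_c ↦ S_c` for the other letters. -/
noncomputable def twistFamily (a b i : Fin n) : CuntzAlgebra n :=
  if i = a then S n a * S n a else if i = b then twist (S n a) (S n b) else S n i

variable {a b : Fin n}

theorem twistFamily_left : twistFamily a b a = S n a * S n a := if_pos rfl

theorem twistFamily_right (hab : a ≠ b) : twistFamily a b b = twist (S n a) (S n b) := by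
  rw [twistFamily, if_neg hab.symm, if_pos rfl]

theorem twistFamily_of_ne {i : Fin n} (ha : i ≠ a) (hb : i ≠ b) : twistFamily a b i = S n i := by
  rw [twistFamily, if_neg ha, if_neg hb]

theorem star_S_mul_self (i : Fin n) : star (S n i) * S n i = 1 := (isCuntzFamily_S n).isometry i

theorem star_S_mul_S_of_ne {i j : Fin n} (h : i ≠ j) : star (S n i) * S n j = 0 := by
  rw [star_S_mul_S, if_neg h]

theorem isCuntzFamily_twistFamily (hab : a ≠ b) : IsCuntzFamily (twistFamily a b) where
  isometry i := by
    by_cases ha : i = a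
    · rw [ha, twistFamily_left, star_mul, mul_assoc, ← mul_assoc (star (S n a)) (S n a),
        star_S_mul_self, one_mul, star_S_mul_self]
    by_cases hb : i = b
    · rw [hb, twistFamily_right hab]
      exact star_twist_mul_twist (star_S_mul_self a) (star_S_mul_self b) (star_S_mul_S_of_ne hab)
        (star_S_mul_S_of_ne hab.symm)
    · rw [twistFamily_of_ne ha hb, star_S_mul_self]
  sum_range := by
    rw [← (isCuntzFamily_S n).sum_range, ← sub_eq_zero, ← Finset.sum_sub_distrib,
      Finset.sum_eq_add a b hab (fun i _ h => by rw [twistFamily_of_ne h.1 h.2, sub_self])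
        (by simp) (by simp), twistFamily_left, twistFamily_right hab,
      twist_mul_star_twist (star_S_mul_self a) (star_S_mul_self b) (star_S_mul_S_of_ne hab)
        (star_S_mul_S_of_ne hab.symm)]
    abel

/-- The endomorphism of `𝒪_n` given by the Cuntz family `twistFamily a b`. -/
noncomputable def twistHom (hab : a ≠ b) : CuntzAlgebra n →⋆ₐ[ℂ] CuntzAlgebra n :=
  (existsUnique_lift (isCuntzFamily_twistFamily hab)).choose

theorem twistHom_S (hab : a ≠ b) (i : Fin n) : twistHom hab (S n i) = twistFamily a b i :=
  (existsUnique_lift (isCuntzFamily_twistFamily hab)).choose_spec.1 i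

/-- Each cylinder projection is in the image of the diagonal under `twistHom`. By induction on the
length, since each word of length at least `2` arises from a shorter one by applying members of
`twistFamily a b`. -/
theorem cyl_mem_map_twistHom (hab : a ≠ b) (w : List (Fin n)) :
    cyl w ∈ (diagonal n).map (twistHom hab) := by
  set M := (diagonal n).map (twistHom hab)
  have hsa := star_S_mul_self (n := n) a
  have hsb := star_S_mul_self (n := n) b
  have hsab := star_S_mul_S_of_ne hab
  have hsba := star_S_mul_S_of_ne hab.symm
  have hconj : ∀ i, ∀ x ∈ M, twistFamily a b i * x * star (twistFamily a b i) ∈ M := by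
    rintro i _ ⟨d, hd, rfl⟩
    refine ⟨_, S_mul_mul_star_S_mem_diagonal i hd, ?_⟩
    change twistHom hab _ = _ * twistHom hab d * _
    rw [map_mul, map_mul, map_star, twistHom_S]
  have hstep : ∀ i v w, word w = twistFamily a b i * word v → cyl v ∈ M → cyl w ∈ M := by
    intro i v w h hv
    have := hconj i _ hv
    rw [cyl] at this ⊢
    rwa [h, star_mul, mul_assoc, ← mul_assoc (word v), ← mul_assoc]
  have hb1 : cyl [b] ∈ M := by
    have := hconj b _ (hconj b 1 (one_mem M))
    rw [mul_one, twistFamily_right hab, twist_conj_twist_mul_star_twist hsa hsb hsab hsba] at this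
    simpa [cyl, word_cons] using this
  have hc1 : ∀ c, c ≠ a → c ≠ b → cyl [c] ∈ M := fun c hca hcb =>
    hstep c [] [c] (by rw [twistFamily_of_ne hca hcb, word_cons])
      (by rw [cyl_nil]; exact one_mem M)
  have ha1 : cyl [a] ∈ M := by
    have h1 : cyl [a] = 1 - ∑ i ∈ Finset.univ.erase a, cyl [i] := by
      rw [eq_sub_iff_add_eq,
        Finset.add_sum_erase _ (fun i => cyl [i]) (Finset.mem_univ a), sum_cyl_singleton]
    rw [h1]
    refine sub_mem (one_mem M) (sum_mem fun i hi => ?_)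
    by_cases hib : i = b
    · rw [hib]; exact hb1
    · exact hc1 i (Finset.ne_of_mem_erase hi) hib
  induction hl : w.length using Nat.strong_induction_on generalizing w with
  | _ m ih =>
  subst hl
  rcases w with _ | ⟨i, _ | ⟨j, w⟩⟩
  · rw [cyl_nil]; exact one_mem M
  · by_cases hia : i = a
    · rw [hia]; exact ha1
    by_cases hib : i = b
    · rw [hib]; exact hb1
    · exact hc1 i hia hib
  have ih0 : cyl w ∈ M := ih _ (by simp) w rfl
  have ih1 : ∀ k, cyl (k :: w) ∈ M := fun k => ih _ (by simp) (k :: w) rfl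
  have htb := twistFamily_right hab
  have haa : cyl (a :: a :: w) ∈ M :=
    hstep a w _ (by rw [twistFamily_left, word_cons, word_cons, mul_assoc]) ih0
  have hacM : ∀ c, c ≠ a → c ≠ b → cyl (a :: c :: w) ∈ M := fun c hca hcb =>
    hstep b (c :: w) _ (by
      rw [htb, word_cons, word_cons, ← mul_assoc, ← mul_assoc, twist_mul_of_orthogonal
        (star_S_mul_S_of_ne hca.symm) (star_S_mul_S_of_ne hcb.symm)]) (ih1 c)
  have habM : cyl (a :: b :: w) ∈ M :=
    hstep b (a :: a :: w) _ (by
      simp only [word_cons, ← mul_assoc]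
      rw [htb, mul_assoc (twist _ _), twist_mul_left_left hsa hsba]) haa
  by_cases hia : i = a
  · subst hia
    by_cases hja : j = i
    · subst hja; exact haa
    by_cases hjb : j = b
    · subst hjb; exact habM
    · exact hacM j hja hjb
  by_cases hib : i = b
  · subst hib
    by_cases hja : j = a
    · subst hja
      exact hstep i (j :: i :: w) _ (by
        simp only [word_cons, ← mul_assoc]
        rw [htb, mul_assoc (twist _ _), twist_mul_left_right hsa hsb hsab hsba]) habM
    by_cases hjb : j = i
    · subst hjb
      exact hstep j (j :: w) _ (by
        simp only [word_cons, ← mul_assoc]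
        rw [htb, twist_mul_right hsb hsab]) (ih1 j)
    · exact hstep i (a :: j :: w) _ (by
        simp only [word_cons, ← mul_assoc]
        rw [htb, mul_assoc (twist _ _), twist_mul_left_of_orthogonal hsa hsba
          (star_S_mul_S_of_ne (Ne.symm hja)) (star_S_mul_S_of_ne (Ne.symm hjb))]) (hacM j hja hjb)
  · exact hstep i (j :: w) _ (by rw [twistFamily_of_ne hia hib, word_cons]) (ih1 j)

/-- A vector state of `𝒪_n` at a vector fixed by `S_a` is determined by this property. -/
theorem inner_eq_of_fixed {H : Type*} [NormedAddCommGroup H] [InnerProductSpace ℂ H]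
    [CompleteSpace H] {ρ σ : CuntzAlgebra n →⋆ₐ[ℂ] (H →L[ℂ] H)} {e : H} (a : Fin n)
    (hρ : ρ (S n a) e = e) (hσ : σ (S n a) e = e) (x : CuntzAlgebra n) :
    inner ℂ e (ρ x e) = inner ℂ e (σ x e) := by
  have hstar : ∀ τ : CuntzAlgebra n →⋆ₐ[ℂ] (H →L[ℂ] H), τ (S n a) e = e → ∀ i,
      τ (star (S n i)) e = if i = a then e else 0 := by
    intro τ hτ i
    conv_lhs => rw [← hτ]
    rw [← mul_apply_eq_comp, ← map_mul, star_S_mul_S]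
    split_ifs <;> simp
  have hword : ∀ τ : CuntzAlgebra n →⋆ₐ[ℂ] (H →L[ℂ] H), τ (S n a) e = e → ∀ w : List (Fin n),
      τ (star (word w)) e = if ∀ i ∈ w, i = a then e else 0 := by
    intro τ hτ w
    induction w with
    | nil => simp
    | cons i w ih =>
      rw [word_cons, star_mul, map_mul, mul_apply_eq_comp, hstar τ hτ]
      by_cases hia : i = a
      · simp [hia, ih]
      · simp [hia]
  have hdense : Dense (wordSpan n : Set (CuntzAlgebra n)) := fun y =>
    Metric.mem_closure_iff.2 fun ε hε => by
      obtain ⟨z, hz, hyz⟩ := exists_wordSpan_norm_sub_lt y hε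
      exact ⟨z, hz, by rwa [dist_eq_norm]⟩
  have hcont : ∀ τ : CuntzAlgebra n →⋆ₐ[ℂ] (H →L[ℂ] H),
      Continuous fun y => inner ℂ e (τ y e) := fun τ =>
    continuous_const.inner ((continuous_hom τ).clm_apply continuous_const)
  refine congrFun ((hcont ρ).ext_on hdense (hcont σ) fun y hy => ?_) x
  rw [SetLike.mem_coe] at hy
  induction hy using Submodule.span_induction with
  | mem y hy =>
    obtain ⟨⟨v, w⟩, rfl⟩ := hy
    have h : ∀ τ : CuntzAlgebra n →⋆ₐ[ℂ] (H →L[ℂ] H), inner ℂ e (τ (word v * star (word w)) e) =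
        inner ℂ (τ (star (word v)) e) (τ (star (word w)) e) := fun τ => by
      rw [map_mul, mul_apply_eq_comp, map_star τ (word v), ContinuousLinearMap.star_eq_adjoint,
        ContinuousLinearMap.adjoint_inner_left]
    simp only [h, hword ρ hρ, hword σ hσ]
  | zero => simp
  | add y z _ _ hy hz => simp only [map_add, add_apply, inner_add_right, hy, hz]
  | smul c y _ hy => simp only [map_smul, smul_apply, inner_smul_right, hy]

/-- The gauge automorphism of `𝒪_n` that maps each `S_i` to `-S_i`. -/
theorem exists_hom_S_eq_neg_S (n : ℕ) :
    ∃ φ : CuntzAlgebra n →⋆ₐ[ℂ] CuntzAlgebra n, ∀ i, φ (S n i) = -S n i := by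
  have h : IsCuntzFamily fun i => -S n i :=
    ⟨fun i => by simpa using (isCuntzFamily_S n).isometry i,
      by simpa using (isCuntzFamily_S n).sum_range⟩
  exact (existsUnique_lift h).exists

/-- The range of `twistHom` does not contain `S_a`: the vector state at `e_{aaa…}` and its
composition with the gauge automorphism `S_i ↦ -S_i` agree on the range, as `S_a ↦ S_a^2`, but
not at `S_a`. -/
theorem isProper_twistHom (hab : a ≠ b) : IsProper (twistHom hab) := by
  intro hbij
  obtain ⟨y, hy⟩ := hbij.2 (S n a)
  obtain ⟨φ, hφ⟩ := exists_hom_S_eq_neg_S n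
  have hcons : Stream'.cons a (Stream'.const a) = Stream'.const a := (Stream'.const_eq a).symm
  have hfix : permRep n (S n a) (basisVec (Stream'.const a)) = basisVec (Stream'.const a) := by
    rw [permRep_S_basisVec, hcons]
  have hfix2 : permRep n (S n a * S n a) (basisVec (Stream'.const a)) =
      basisVec (Stream'.const a) := by
    rw [permRep_mul_apply, hfix, hfix]
  have h := inner_eq_of_fixed (ρ := (permRep n).comp (twistHom hab))
    (σ := (permRep n).comp (φ.comp (twistHom hab))) a
    (by simpa [twistHom_S, twistFamily_left] using hfix2)
    (by simpa [twistHom_S, twistFamily_left, hφ] using hfix2) y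
  simp only [StarAlgHom.comp_apply, hy, hφ, map_neg, neg_apply, hfix, inner_neg_right,
    inner_basisVec_self] at h
  norm_num at h

/-- There is a proper endomorphism of `𝒪_n` that restricts to an automorphism of the diagonal. -/
theorem exists_isProper_extends (hn : 2 ≤ n) :
    ∃ (γ : CuntzAlgebra n →⋆ₐ[ℂ] CuntzAlgebra n) (α : diagonal n ≃⋆ₐ[ℂ] diagonal n),
      IsProper γ ∧ Extends γ α := by
  have hab : (⟨0, by omega⟩ : Fin n) ≠ ⟨1, by omega⟩ := by simp
  obtain ⟨α, hα⟩ := exists_extends_of_cyl_mem_map hn (twistHom hab) fun w =>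
    cyl_mem_map_twistHom hab w
  exact ⟨_, α, isProper_twistHom hab, hα⟩

theorem Extends.mem_range_restriction {γ : CuntzAlgebra n →⋆ₐ[ℂ] CuntzAlgebra n}
    {α : diagonal n ≃⋆ₐ[ℂ] diagonal n} (h : Extends γ α) : α ∈ Set.range (restriction n) :=
  ⟨⟨γ, α, h⟩, Extends.unique (fun x => (restriction_apply _ x).symm) h⟩

theorem exists_extends_of_mem_range_restriction {α : diagonal n ≃⋆ₐ[ℂ] diagonal n}
    (h : α ∈ Set.range (restriction n)) :
    ∃ γ : CuntzAlgebra n →⋆ₐ[ℂ] CuntzAlgebra n, Extends γ α := by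
  obtain ⟨γ, rfl⟩ := h
  exact ⟨γ, fun x => (restriction_apply γ x).symm⟩

/-- The inverse of an automorphism that extends to a proper endomorphism does not extend. -/
theorem inv_notMem_range_restriction (hn : 2 ≤ n) {γ : CuntzAlgebra n →⋆ₐ[ℂ] CuntzAlgebra n}
    {α : diagonal n ≃⋆ₐ[ℂ] diagonal n} (hγ : IsProper γ) (h : Extends γ α) :
    α⁻¹ ∉ Set.range (restriction n) := fun hα => by
  obtain ⟨δ, hδ⟩ := exists_extends_of_mem_range_restriction hα
  exact hγ (h.bijective_of_inv hn hδ)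

end CuntzAlgebra

theorem theorem3p3 (n : ℕ) (hn : 2 ≤ n) :
    ¬ Function.Surjective (CuntzAlgebra.restriction n) ∧
    (¬ ∃ H : Subgroup (CuntzAlgebra.diagonal n ≃⋆ₐ[ℂ] CuntzAlgebra.diagonal n),
      (H : Set (CuntzAlgebra.diagonal n ≃⋆ₐ[ℂ] CuntzAlgebra.diagonal n)) =
        Set.range (CuntzAlgebra.restriction n)) ∧
    ∃ (H : Subgroup (CuntzAlgebra.diagonal n ≃⋆ₐ[ℂ] CuntzAlgebra.diagonal n))
      (P : Subsemigroup (CuntzAlgebra.diagonal n ≃⋆ₐ[ℂ] CuntzAlgebra.diagonal n)),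
      (H : Set (CuntzAlgebra.diagonal n ≃⋆ₐ[ℂ] CuntzAlgebra.diagonal n)) =
        {α | ∃ γ : CuntzAlgebra n ≃⋆ₐ[ℂ] CuntzAlgebra n,
          CuntzAlgebra.Extends (γ : CuntzAlgebra n →⋆ₐ[ℂ] CuntzAlgebra n) α} ∧
      (P : Set (CuntzAlgebra.diagonal n ≃⋆ₐ[ℂ] CuntzAlgebra.diagonal n)) =
        {α | ∃ γ : CuntzAlgebra n →⋆ₐ[ℂ] CuntzAlgebra n,
          CuntzAlgebra.IsProper γ ∧ CuntzAlgebra.Extends γ α} ∧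
      Set.range (CuntzAlgebra.restriction n) = (H : Set _) ∪ (P : Set _) ∧
      Disjoint (H : Set (CuntzAlgebra.diagonal n ≃⋆ₐ[ℂ] CuntzAlgebra.diagonal n)) (P : Set _) := by
  obtain ⟨γ₀, α₀, hγ₀, hα₀⟩ := CuntzAlgebra.exists_isProper_extends hn
  have hinv := CuntzAlgebra.inv_notMem_range_restriction hn hγ₀ hα₀
  refine ⟨fun hsurj => hinv (hsurj α₀⁻¹), ?_, ?_⟩
  · rintro ⟨H, hH⟩
    rw [← hH] at hinv
    refine hinv (H.inv_mem (SetLike.mem_coe.1 ?_))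
    rw [hH]
    exact hα₀.mem_range_restriction
  · let H : Subgroup (CuntzAlgebra.diagonal n ≃⋆ₐ[ℂ] CuntzAlgebra.diagonal n) :=
      { carrier := {α | ∃ γ : CuntzAlgebra n ≃⋆ₐ[ℂ] CuntzAlgebra n,
          CuntzAlgebra.Extends (γ : CuntzAlgebra n →⋆ₐ[ℂ] CuntzAlgebra n) α}
        one_mem' := ⟨1, CuntzAlgebra.Extends.one n⟩
        mul_mem' := fun ⟨γ, h⟩ ⟨δ, k⟩ => ⟨γ * δ, h.mul k⟩
        inv_mem' := fun ⟨γ, h⟩ => ⟨γ⁻¹, h.inv⟩ }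
    let P : Subsemigroup (CuntzAlgebra.diagonal n ≃⋆ₐ[ℂ] CuntzAlgebra.diagonal n) :=
      { carrier := {α | ∃ γ : CuntzAlgebra n →⋆ₐ[ℂ] CuntzAlgebra n,
          CuntzAlgebra.IsProper γ ∧ CuntzAlgebra.Extends γ α}
        mul_mem' := fun ⟨γ, hγ, h⟩ ⟨δ, _, k⟩ => ⟨γ * δ, h.isProper_mul hn k hγ, h.mul k⟩ }
    refine ⟨H, P, rfl, rfl, Set.Subset.antisymm (fun α hα => ?_) ?_, ?_⟩
    · obtain ⟨γ, hγ⟩ := CuntzAlgebra.exists_extends_of_mem_range_restriction hα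
      by_cases hbij : Function.Bijective γ
      · obtain ⟨θ, rfl⟩ := CuntzAlgebra.exists_starAlgEquiv_coe_eq hbij
        exact Or.inl ⟨θ, hγ⟩
      · exact Or.inr ⟨γ, hbij, hγ⟩
    · rintro α (⟨θ, hθ⟩ | ⟨γ, -, hγ⟩)
      · exact hθ.mem_range_restriction
      · exact hγ.mem_range_restriction
    · rw [Set.disjoint_left]
      rintro α ⟨θ, hθ⟩ ⟨γ, hγ, h⟩
      exact hγ (h.bijective_of_starAlgEquiv hn hθ)
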